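/- Setting. Discounted LTL formulas over a finite set $\mathcal{P}$ of atomic propositions are given by $\varphi ::= b\in\mathcal{P}\mid\lnot\varphi\mid\varphi\lor\varphi\mid\mathbf{X}_\lambda\varphi\mid\varphi\,\mathbf{U}_\lambda\varphi$ with $\lambda\in[0,1)$. The value $[\![\varphi,\rho]\!]\in[0,1]$ of $\varphi$ on an infinite word $\rho=\sigma_0\sigma_1\ldots\in(2^{\mathcal{P}})^\omega$, with suffixes $\rho_{i:\infty}=\sigma_i\sigma_{i+1}\ldots$, is $[\![b,\rho]\!]=\mathbb{1}(b\in\sigma_0)$, $[\![\lnot\varphi,\rho]\!]=1-[\![\varphi,\rho]\!]$, $[\![\varphi_1\lor\varphi_2,\rho]\!]=\max\{[\![\varphi_1,\rho]\!],[\![\varphi_2,\rho]\!]\}$, $[\![\mathbf{X}_\lambda\varphi,\rho]\!]=\lambda[\![\varphi,\rho_{1:\infty}]\!]$ and $[\![\varphi_1\mathbf{U}_\lambda\varphi_2,\rho]\!]=\sup_{i\ge0}\min\{\lambda^i[\![\varphi_2,\rho_{i:\infty}]\!],\min_{0\le j<i}\lambda^j[\![\varphi_1,\rho_{j:\infty}]\!]\}$,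 with $\lambda^0=1$. The formula is uniformly discounted if all its temporal operators use one common discount factor $\lambda\in[0,1)$. A Markov decision process (MDP) $\mathcal{M}=(S,A,s_0,P)$ has a finite set $S$ of states, a finite non-empty set $A$ of actions, an initial state $s_0\in S$, and transition distributions $P(s,a,\cdot)$ on $S$. A policy maps every finite run $s_0a_0\ldots a_{t-1}s_t$ to a probability distribution on $A$. A policy $\pi$ induces the probability measure on infinite runs for which the cylinder of $h=s_0a_0\ldots s_t$ has probability $\prod_{i<t}\pi(s_0a_0\ldots s_i)(a_i)\,P(s_i,a_i,s_{i+1})$. For a labelling function $L:S\to2^{\mathcal{P}}$, the value of $\pi$ with respect to $\varphi$ is the expectation of $[\![\varphi,L(s_0)L(s_1)\ldots]\!]$ under this measure, and $\pi$ is optimal if its value equals the supremum of the values of all policies. A finite-memory policy $(M,\delta,\mu,m_0)$ consists of a finite set $M$, an update function $\delta:M\times S\times A\to M$, an action function $\mu$ that maps $M\times S$ to distributions on $A$, and $m_0\in M$; after the finite run $h's_t$ it samples its action from $\mu(\delta(m_0,h'),s_t)$, where $\delta$ is extended to sequences of state-action pairs. Statement. For every MDP $\mathcal{M}$, every labelling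 function $L$ and every uniformly discounted LTL formula $\varphi$, there exists a finite-memory policy that is optimal. Furthermore, there is an algorithm that computes such a policy: a single partial recursive function which, given (a finite description of) any MDP with rational transition probabilities, any labelling function, and any uniformly discounted LTL formula whose discount factor is rational, halts and outputs (a finite description of) a finite-memory optimal policy, whose action probabilities are rational. -/

import Mathlib

open MeasureTheory ProbabilityTheory

/-! ### Discounted LTL -/

/-- The discount factors of strict discounting: real numbers `lam` with `0 ≤ lam < 1`. -/
abbrev Discount : Type := Set.Ico (0 : ℝ) 1

/-- Formulas of discounted LTL over the atomic propositions `AP`; every temporal operator carries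
its own discount factor. -/
inductive DLTL (AP : Type*) : Type _
  | atom (b : AP) : DLTL AP
  | neg (φ : DLTL AP) : DLTL AP
  | disj (φ ψ : DLTL AP) : DLTL AP
  | next (lam : Discount) (φ : DLTL AP) : DLTL AP
  | untl (lam : Discount) (φ ψ : DLTL AP) : DLTL AP

namespace DLTL

variable {AP : Type*}

/-- All temporal operators of the formula use the common discount factor `lam`. -/
def IsUniform (lam : Discount) : DLTL AP → Prop
  | atom _ => True
  | neg φ => φ.IsUniform lam
  | disj φ ψ => φ.IsUniform lam ∧ ψ.IsUniform lam
  | next l φ => l = lam ∧ φ.IsUniform lam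
  | untl l φ ψ => l = lam ∧ φ.IsUniform lam ∧ ψ.IsUniform lam

/-- The suffix of an infinite word that starts at position `i`. -/
def suffix {α : Type*} (ρ : ℕ → α) (i : ℕ) : ℕ → α := fun n => ρ (i + n)

open Classical in
/-- The value of a formula on an infinite word over the alphabet `2 ^ AP`. In the clause for
`untl`, `fold min b f (range i)` is the minimum of `b` and of all `f j` with `j < i`. -/
noncomputable def value : DLTL AP → (ℕ → Set AP) → ℝ
  | atom b, ρ => if b ∈ ρ 0 then 1 else 0
  | neg φ, ρ => 1 - φ.value ρ
  | disj φ ψ, ρ => max (φ.value ρ) (ψ.value ρ)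
  | next lam φ, ρ => (lam : ℝ) * φ.value (suffix ρ 1)
  | untl lam φ ψ, ρ =>
      ⨆ i : ℕ, (Finset.range i).fold min ((lam : ℝ) ^ i * ψ.value (suffix ρ i))
        (fun j => (lam : ℝ) ^ j * φ.value (suffix ρ j))

end DLTL

/-! ### Markov decision processes and policies -/

/-- A Markov decision process with states `S` and actions `A` (finite types in all uses). -/
structure MDP (S A : Type*) where
  /-- the initial state -/
  init : S
  /-- the transition probabilities -/
  P : S → A → PMF S

/-- A policy maps a finite run `s₀ a₀ … aₜ₋₁ sₜ`, given as the list of the pairs `(sᵢ, aᵢ)`, `i < t`,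
in chronological order together with the last state `sₜ`, to a distribution over actions. -/
abbrev Policy (S A : Type*) : Type _ := List (S × A) → S → PMF A

/-- A finite-memory policy with memory states `Q` (a finite type in all uses). -/
structure MemoryPolicy (Q S A : Type*) where
  /-- the initial memory state -/
  init : Q
  /-- the memory update -/
  update : Q → S → A → Q
  /-- the action function -/
  act : Q → S → PMF A

/-- The policy induced by a finite-memory policy: after the finite run `h' s` it plays according to
`act (update* init h') s`. -/
noncomputable def MemoryPolicy.toPolicy {Q S A : Type*} (π : MemoryPolicy Q S A) : Policy S A :=
  fun h s => π.act (h.foldl (fun q sa => π.update q sa.1 sa.2) π.init) s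

namespace MDP

section RunMeasure

variable {S A : Type*} [Fintype S] [MeasurableSpace S] [MeasurableSingletonClass S]
  [Fintype A] [MeasurableSpace A] [MeasurableSingletonClass A]

/-- The law of `(s₀, a₀)`: the first state is the initial one, the first action is sampled from the
policy. -/
noncomputable def initLaw (M : MDP S A) (π : Policy S A) : PMF (S × A) :=
  (π [] M.init).map fun a => (M.init, a)

/-- The list `(s₀, a₀), …, (sₙ, aₙ)`. -/
def history {n : ℕ} (x : (i : Finset.Iic n) → S × A) : List (S × A) :=
  List.ofFn fun i : Fin (n + 1) => x ⟨i, Finset.mem_Iic.2 (Nat.lt_succ_iff.1 i.2)⟩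

/-- The conditional law of `(sₙ₊₁, aₙ₊₁)` given `(s₀, a₀), …, (sₙ, aₙ)`. -/
noncomputable def stepLaw (M : MDP S A) (π : Policy S A) {n : ℕ}
    (x : (i : Finset.Iic n) → S × A) : PMF (S × A) :=
  (M.P (x ⟨n, Finset.mem_Iic.2 le_rfl⟩).1 (x ⟨n, Finset.mem_Iic.2 le_rfl⟩).2).bind fun s =>
    (π (history x) s).map fun a => (s, a)

/-- `stepLaw` as a probability kernel. -/
noncomputable def stepKernel (M : MDP S A) (π : Policy S A) (n : ℕ) :
    Kernel ((i : Finset.Iic n) → S × A) (S × A) where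
  toFun x := (M.stepLaw π x).toMeasure
  measurable' := measurable_of_countable _

instance (M : MDP S A) (π : Policy S A) (n : ℕ) : IsMarkovKernel (M.stepKernel π n) :=
  ⟨fun x => inferInstanceAs (IsProbabilityMeasure (M.stepLaw π x).toMeasure)⟩

/-- The probability measure on infinite runs `s₀ a₀ s₁ a₁ …` induced by a policy. -/
noncomputable def runMeasure (M : MDP S A) (π : Policy S A) : Measure (ℕ → S × A) :=
  Kernel.trajMeasure (M.initLaw π).toMeasure (M.stepKernel π)

instance (M : MDP S A) (π : Policy S A) : IsProbabilityMeasure (M.runMeasure π) := by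
  unfold runMeasure; infer_instance

/-- The law of the next step given the run so far. -/
theorem run_step (M : MDP S A) (π : Policy S A) (x : ℕ → S × A) (n : ℕ) (B : Set (S × A)) :
    M.runMeasure π {ψ | (∀ i ≤ n, ψ i = x i) ∧ ψ (n + 1) ∈ B} =
      M.runMeasure π {ψ | ∀ i ≤ n, ψ i = x i} *
        (M.stepLaw π (n := n) (fun i => x i)).toMeasure B := by
  have hB : MeasurableSet B := B.toFinite.measurableSet
  have h := congrArg (fun (μ : Measure ((Finset.Iic n → S × A) × (S × A))) => μ (({fun i : Finset.Iic n => x i} : Set (Finset.Iic n → S × A)) ×ˢ B))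
    (Kernel.map_frestrictLe_trajMeasure_compProd_eq_map_trajMeasure (X := fun _ => S × A)
      (μ₀ := (M.initLaw π).toMeasure) (κ := M.stepKernel π) (a := n))
  beta_reduce at h
  have m1 : MeasurableSet ({fun i : Finset.Iic n => x i} : Set (Finset.Iic n → S × A)) :=
    MeasurableSet.singleton _
  rw [Measure.compProd_apply_prod m1 hB, Measure.map_apply (by fun_prop) (m1.prod hB),
    lintegral_singleton, Measure.map_apply (by fun_prop) m1] at h
  have e2 : (Preorder.frestrictLe (π := fun _ => S × A) n) ⁻¹' ({fun i : Finset.Iic n => x i} : Set (Finset.Iic n → S × A)) =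
      {ψ | ∀ i ≤ n, ψ i = x i} := by
    ext ψ
    simp only [Set.mem_preimage, Set.mem_singleton_iff, Set.mem_ofPred_eq, funext_iff]
    exact ⟨fun h i hi => h ⟨i, Finset.mem_Iic.2 hi⟩, fun h i => h i (Finset.mem_Iic.1 i.2)⟩
  rw [e2, mul_comm] at h
  refine Eq.trans ?_ h.symm
  change _ = M.runMeasure π _
  congr 1
  ext ψ
  have := Set.ext_iff.1 e2 ψ
  simp only [Set.mem_preimage, Set.mem_ofPred_eq] at this
  simp only [Set.mem_preimage, Set.mem_prod, Set.mem_ofPred_eq, this]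

/-- The probability of the cylinder of a finite run `s₀ a₀ … aₜ₋₁ sₜ` is the product of the
probabilities `π(s₀ a₀ … sᵢ)(aᵢ) * P(sᵢ, aᵢ, sᵢ₊₁)`, `i < t`. -/
theorem runMeasure_cylinder (M : MDP S A) (π : Policy S A) (x : ℕ → S × A)
    (hx : (x 0).1 = M.init) (t : ℕ) :
    M.runMeasure π {ψ | (∀ i < t, ψ i = x i) ∧ (ψ t).1 = (x t).1} =
      ∏ i ∈ Finset.range t, π (List.ofFn fun j : Fin i => x j) (x i).1 (x i).2 *
        M.P (x i).1 (x i).2 (x (i + 1)).1 := by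
  classical
  have fst_map : ∀ (p : PMF A) (s : S), (p.map fun a => (s, a)).map Prod.fst = PMF.pure s := by
    intro p s
    rw [PMF.map_comp]
    exact PMF.map_const _ _
  have pair : ∀ (p : PMF A) (s t : S) (a : A),
      (p.map fun b => (s, b)) (t, a) = (if t = s then 1 else 0) * p a := by
    intro p s t a
    rw [PMF.map_apply]
    by_cases h : t = s
    · subst h; simp
    · simp [h]
  have mm : ∀ B : Set (S × A), MeasurableSet B := fun B => B.toFinite.measurableSet
  have zero : (M.runMeasure π).map (fun ψ => ψ 0) = (M.initLaw π).toMeasure := by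
    unfold runMeasure Kernel.trajMeasure
    rw [Measure.map_comp _ _ (by fun_prop)]
    have : (Kernel.traj (X := fun _ => S × A) (M.stepKernel π) 0).map (fun ψ => ψ 0) =
        Kernel.deterministic (fun x : (i : Finset.Iic 0) → S × A => x ⟨0, by simp⟩)
          (by fun_prop) := by
      have h := Kernel.traj_map_frestrictLe (X := fun _ => S × A) (κ := M.stepKernel π) 0 0
      have h2 : (fun ψ : ℕ → S × A => ψ 0) =
        (fun x : (i : Finset.Iic 0) → S × A => x ⟨0, by simp⟩) ∘ Preorder.frestrictLe 0 := rfl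
      rw [h2, Kernel.map_comp_right _ (Preorder.measurable_frestrictLe (X := fun _ : ℕ => S × A) 0) (by fun_prop), h, Kernel.partialTraj_self]
      rw [Kernel.id_map]
    rw [this, Measure.deterministic_comp_eq_map, Measure.map_map (by fun_prop) (by fun_prop)]
    exact Measure.map_id
  have stepFst : ∀ (n : ℕ) (y : (i : Finset.Iic n) → S × A) (s : S),
      (M.stepLaw π y).toMeasure {z | z.1 = s} =
      M.P (y ⟨n, by simp⟩).1 (y ⟨n, by simp⟩).2 s := by
    intro n y s
    have h : (M.stepLaw π y).map Prod.fst = M.P (y ⟨n, by simp⟩).1 (y ⟨n, by simp⟩).2 := by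
      unfold stepLaw
      rw [PMF.map_bind]
      simp only [fst_map, PMF.bind_pure]
    rw [← h, ← PMF.toMeasure_apply_singleton _ _ (measurableSet_singleton s),
      PMF.toMeasure_map_apply _ _ _ measurable_fst (measurableSet_singleton s)]
    rfl
  have D : ∀ n, M.runMeasure π {ψ | ∀ i ≤ n, ψ i = x i} =
      (∏ i ∈ Finset.range n, π (List.ofFn fun j : Fin i => x j) (x i).1 (x i).2 *
        M.P (x i).1 (x i).2 (x (i + 1)).1) * π (List.ofFn fun j : Fin n => x j) (x n).1 (x n).2 := by
    intro n
    induction n with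
    | zero =>
      have h := congrArg (fun μ : Measure (S × A) => μ {x 0}) zero
      beta_reduce at h
      rw [Measure.map_apply (by fun_prop) (mm _),
        PMF.toMeasure_apply_singleton _ _ (mm _)] at h
      have e : {ψ : ℕ → S × A | ∀ i ≤ 0, ψ i = x i} = (fun ψ => ψ 0) ⁻¹' {x 0} := by
        ext ψ; simp
      rw [e, h]
      unfold initLaw
      have := pair (π [] M.init) M.init (x 0).1 (x 0).2
      rw [Prod.mk.eta] at this
      rw [this]; simp [hx]
    | succ n ih =>
      have e : {ψ : ℕ → S × A | ∀ i ≤ n + 1, ψ i = x i} =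
          {ψ | (∀ i ≤ n, ψ i = x i) ∧ ψ (n + 1) ∈ ({x (n + 1)} : Set (S × A))} := by
        ext ψ
        simp only [Set.mem_ofPred_eq, Set.mem_singleton_iff]
        exact ⟨fun h => ⟨fun i hi => h i (by omega), h _ le_rfl⟩, fun h i hi => by
          rcases Nat.le_succ_iff.1 hi with h' | h'
          · exact h.1 i h'
          · subst h'; exact h.2⟩
      rw [e, run_step, ih, Finset.prod_range_succ, PMF.toMeasure_apply_singleton _ _ (mm _)]
      have : M.stepLaw π (n := n) (fun i => x i) (x (n + 1)) =
          M.P (x n).1 (x n).2 (x (n + 1)).1 *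
            π (List.ofFn fun j : Fin (n + 1) => x j) (x (n + 1)).1 (x (n + 1)).2 := by
        unfold stepLaw
        rw [PMF.bind_apply, tsum_eq_single (x (n + 1)).1]
        · have := pair (π (history (n := n) fun i => x i) (x (n + 1)).1) (x (n + 1)).1
            (x (n + 1)).1 (x (n + 1)).2
          rw [Prod.mk.eta] at this
          rw [this]; simp [history]
        · intro s hs
          have := pair (π (history (n := n) fun i => x i) s) s (x (n + 1)).1 (x (n + 1)).2
          rw [Prod.mk.eta] at this
          rw [this]; simp [Ne.symm hs]
      rw [this]; ring
  cases t with
  | zero =>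
    have h := congrArg (fun μ : Measure (S × A) => μ {z | z.1 = M.init}) zero
    beta_reduce at h
    rw [Measure.map_apply (by fun_prop) (mm _)] at h
    have h2 : (M.initLaw π).toMeasure {z | z.1 = M.init} = 1 := by
      have h3 : (M.initLaw π).map Prod.fst = PMF.pure M.init := fst_map _ _
      have := PMF.toMeasure_map_apply Prod.fst (M.initLaw π) {M.init}
        (measurable_fst : Measurable (Prod.fst : S × A → S))
        (measurableSet_singleton _)
      rw [h3, PMF.toMeasure_apply_singleton _ _ (measurableSet_singleton _)] at this
      rw [PMF.pure_apply, if_pos rfl] at this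
      exact this.symm
    simpa [hx, h2] using h
  | succ n =>
    have := run_step M π x n {z | z.1 = (x (n + 1)).1}
    rw [stepFst, D] at this
    rw [Finset.prod_range_succ, ← mul_assoc]
    rw [← this]
    simp only [Nat.lt_succ_iff, Set.mem_ofPred_eq]
/-- The value of a policy with respect to a formula: the expected value of the formula on the word
of labels of the run. -/
noncomputable def policyValue {AP : Type*} (M : MDP S A) (L : S → Set AP) (φ : DLTL AP)
    (π : Policy S A) : ℝ :=
  ∫ ψ, φ.value (fun n => L (ψ n).1) ∂(M.runMeasure π)

/-- The optimal value: the supremum of the values of all policies. -/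
noncomputable def optimalValue {AP : Type*} (M : MDP S A) (L : S → Set AP) (φ : DLTL AP) : ℝ :=
  ⨆ π : Policy S A, M.policyValue L φ π

/-- The policy attains the optimal value. -/
def IsOptimal {AP : Type*} (M : MDP S A) (L : S → Set AP) (φ : DLTL AP) (π : Policy S A) : Prop :=
  M.policyValue L φ π = M.optimalValue L φ

end RunMeasure

end MDP

/-! ### Finite encodings of inputs and outputs of algorithms -/

/-- A nonnegative rational number is written as its numerator and denominator. -/
def ratCode (q : ℚ≥0) : ℕ × ℕ := (q.num, q.den)

/-- A formula over the propositions `Fin k` is written as the list of its tokens in prefix (Polish)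
notation. The common discount factor is written separately. -/
def DLTL.tokens {k : ℕ} : DLTL (Fin k) → List (ℕ × ℕ)
  | .atom b => [(0, (b : ℕ))]
  | .neg φ => (1, 0) :: φ.tokens
  | .disj φ ψ => (2, 0) :: (φ.tokens ++ ψ.tokens)
  | .next _ φ => (3, 0) :: φ.tokens
  | .untl _ φ ψ => (4, 0) :: (φ.tokens ++ ψ.tokens)

/-- Codes of instances: the numbers of states, actions and propositions, the initial state, the table
of transition probabilities, the table of labels, the discount factor, the tokens of the formula. -/
abbrev InstanceCode : Type :=
  (ℕ × ℕ × ℕ) × ℕ × List (List (List (ℕ × ℕ))) × List (List Bool) × (ℕ × ℕ) × List (ℕ × ℕ)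

open Classical in
/-- The code of an instance with states `Fin n`, actions `Fin m`, propositions `Fin k`, initial state
`s₀`, rational transition probabilities `p`, labelling function `L`, and a formula `φ` all of whose
temporal operators use the rational discount factor `r`. -/
noncomputable def instanceCode {n m k : ℕ} (s₀ : Fin n) (p : Fin n → Fin m → Fin n → ℚ≥0)
    (L : Fin n → Set (Fin k)) (r : ℚ≥0) (φ : DLTL (Fin k)) : InstanceCode :=
  ((n, m, k), (s₀ : ℕ),
    (List.ofFn fun s => List.ofFn fun a => List.ofFn fun s' => ratCode (p s a s')),
    (List.ofFn fun s => List.ofFn fun b => decide (b ∈ L s)),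
    ratCode r, φ.tokens)

/-- Codes of finite-memory policies: the number of memory states, the initial memory state, the table
of the memory update, the table of the action probabilities. -/
abbrev PolicyCode : Type :=
  ℕ × ℕ × List (List (List ℕ)) × List (List (List (ℕ × ℕ)))

/-- The code of a finite-memory policy with memory states `Fin c` and rational action
probabilities `w`. -/
def policyCode {c n m : ℕ} (q₀ : Fin c) (u : Fin c → Fin n → Fin m → Fin c)
    (w : Fin c → Fin n → Fin m → ℚ≥0) : PolicyCode :=
  (c, (q₀ : ℕ),
    (List.ofFn fun q => List.ofFn fun s => List.ofFn fun a => (u q s a : ℕ)),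
    (List.ofFn fun q => List.ofFn fun s => List.ofFn fun a => ratCode (w q s a)))

/-!
Let `λ` be the common discount factor. The values of all formulas on a word `σ · ρ` are obtained from
the values on `ρ` by one `DLTL.unfold` step, in which every temporal operator multiplies by `λ` once.
Hence the value on `u · ρ` is a function of the values on `ρ` that oscillates by at most `λ ^ |u|`, and
the values on finite words (`DLTL.horizon`, with the value `0` beyond the horizon) converge to the
value of the infinite word.

*Finitely many residuals.* Divided by `λ ^ |u|`, the value on `u · ρ` is a lattice polynomial in
functions `γ + ε * x ψ`, where `x ψ` is the value of a subformula `ψ` on `ρ`, `ε ∈ {-1, 0, 1}`, and `γ`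
is a signed sum of boundedly many powers of `1 / λ`; only a negation adds a summand, so that the number
of summands does not depend on `u` (`DLTL.scaled_horizon_mem_latticeClosure`). After subtracting the
value at `0`, which is again such a sum, the function has values in `[-1, 1]`, so that all terms may be
truncated to this interval and only the `γ ∈ [-2, 2]` matter. These are finitely many
(`signedSums.finite_inter_Icc`), and a finitely generated distributive lattice is finite. So the
normalized functions, the residuals, are finite in number. They are the states of a finite automaton
whose rewards are the normalized increments of the finite-horizon values, and the value of the formula
is the discounted sum of these rewards (`DLTL.exists_isRewardMachine`).

*Optimal policies.* The product of the decision process with the automaton is a finite discounted-sum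
problem. A solution of its Bellman equation, which exists by Banach's fixed point theorem, yields an
optimal policy whose memory is the automaton (`MDP.isOptimal_of_bellman`): the collected reward plus the
discounted continuation value is a supermartingale under every policy and a martingale under the greedy
one.

*The algorithm* searches for a certificate: an automaton with rewards, a solution of the Bellman
equation and a greedy choice of actions, all with rational data. The Bellman equation is a finite
condition. That the rewards are the right ones is a condition on all finite words; since the state of
the automaton together with the residual takes at most a computable number of values
(`DLTL.residualBound`, a quantitative version of the finiteness above for rational `λ`), words of bounded
length suffice (`DLTL.isRewardMachine_of_bounded`). So the test of a certificate is primitive recursive.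
A certificate exists because the residual automaton has rational rewards and the Bellman equation then
has a rational solution (`MDP.exists_rational_bellman`).
-/

/-! ### Unfolding formulas along finite words -/

namespace DLTL

variable {AP : Type*}

open Classical in
/-- One step of the semantics: the values of all formulas on `σ · ρ`, computed from the first letter
`σ` and from the values `x` of all formulas on `ρ`. -/
noncomputable def unfold (σ : Set AP) (x : DLTL AP → ℝ) : DLTL AP → ℝ
  | atom b => if b ∈ σ then 1 else 0
  | neg φ => 1 - unfold σ x φ
  | disj φ ψ => max (unfold σ x φ) (unfold σ x ψ)
  | next l φ => (l : ℝ) * x φ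
  | untl l φ ψ => max (unfold σ x ψ) (min (unfold σ x φ) ((l : ℝ) * x (untl l φ ψ)))

/-- The values of all formulas on a word `u · ρ`, computed from the finite word `u` and from the
values `x` of all formulas on `ρ`. With `x = 0` this is a finite-horizon approximation. -/
noncomputable def horizon (u : List (Set AP)) (x : DLTL AP → ℝ) : DLTL AP → ℝ :=
  u.foldr unfold x

/-- The valuations of formulas that are considered: all values lie in `[0, 1]`. -/
def IsUnitValued (x : DLTL AP → ℝ) : Prop := ∀ φ, 0 ≤ x φ ∧ x φ ≤ 1

/-- The type of such valuations. -/
abbrev Valuation (AP : Type*) : Type _ := {x : DLTL AP → ℝ // IsUnitValued x}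

theorem horizon_nil (x : DLTL AP → ℝ) : horizon [] x = x := rfl

theorem horizon_cons (σ : Set AP) (u : List (Set AP)) (x : DLTL AP → ℝ) :
    horizon (σ :: u) x = unfold σ (horizon u x) := rfl

theorem horizon_append (u v : List (Set AP)) (x : DLTL AP → ℝ) :
    horizon (u ++ v) x = horizon u (horizon v x) := by
  simp [horizon]

theorem isUnitValued_zero : IsUnitValued (0 : DLTL AP → ℝ) := fun _ => by simp

theorem isUnitValued_unfold (σ : Set AP) {x : DLTL AP → ℝ} (hx : IsUnitValued x) :
    IsUnitValued (unfold σ x) := by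
  have mul : ∀ (l : Discount) (φ : DLTL AP), 0 ≤ (l : ℝ) * x φ ∧ (l : ℝ) * x φ ≤ 1 := fun l φ =>
    ⟨mul_nonneg l.2.1 (hx φ).1, mul_le_one₀ l.2.2.le (hx φ).1 (hx φ).2⟩
  intro φ
  induction φ with
  | atom b => unfold unfold; split_ifs <;> simp
  | neg φ ih => unfold unfold; exact ⟨by linarith [ih.2], by linarith [ih.1]⟩
  | disj φ ψ ih₁ ih₂ =>
    unfold unfold; exact ⟨le_max_of_le_left ih₁.1, max_le ih₁.2 ih₂.2⟩
  | next l φ ih => exact mul l φ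
  | untl l φ ψ ih₁ ih₂ =>
    unfold unfold
    exact ⟨le_max_of_le_left ih₂.1, max_le ih₂.2 (min_le_of_left_le ih₁.2)⟩

theorem isUnitValued_horizon (u : List (Set AP)) {x : DLTL AP → ℝ} (hx : IsUnitValued x) :
    IsUnitValued (horizon u x) := by
  induction u with
  | nil => exact hx
  | cons σ u ih => exact isUnitValued_unfold σ ih

/-- The one-step unfolding contracts distances by the common discount factor. -/
theorem abs_unfold_sub_le {lam : Discount} (σ : Set AP) {x y : DLTL AP → ℝ} {δ : ℝ} (hδ : 0 ≤ δ)
    (h : ∀ φ, IsUniform lam φ → |x φ - y φ| ≤ δ) (φ : DLTL AP) (hφ : IsUniform lam φ) :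
    |unfold σ x φ - unfold σ y φ| ≤ lam * δ := by
  have mul : ∀ φ, IsUniform lam φ → |(lam : ℝ) * x φ - lam * y φ| ≤ lam * δ := fun φ hφ => by
    rw [← mul_sub, abs_mul, abs_of_nonneg lam.2.1]
    exact mul_le_mul_of_nonneg_left (h φ hφ) lam.2.1
  induction φ with
  | atom b => unfold unfold; simpa using mul_nonneg lam.2.1 hδ
  | neg φ ih =>
    unfold unfold
    rw [sub_sub_sub_cancel_left, abs_sub_comm]
    exact ih hφ
  | disj φ ψ ih₁ ih₂ =>
    unfold unfold
    exact (abs_max_sub_max_le_max _ _ _ _).trans (max_le (ih₁ hφ.1) (ih₂ hφ.2))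
  | next l φ ih =>
    obtain ⟨rfl, hφ⟩ := hφ
    exact mul φ hφ
  | untl l φ ψ ih₁ ih₂ =>
    have hU := hφ
    obtain ⟨rfl, hφ, hψ⟩ := hφ
    unfold unfold
    refine (abs_max_sub_max_le_max _ _ _ _).trans (max_le (ih₂ hψ) ?_)
    exact (abs_min_sub_min_le_max _ _ _ _).trans (max_le (ih₁ hφ) (mul _ hU))

theorem abs_horizon_sub_le {lam : Discount} (u : List (Set AP)) {x y : DLTL AP → ℝ}
    (hx : IsUnitValued x) (hy : IsUnitValued y) (φ : DLTL AP) (hφ : IsUniform lam φ) :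
    |horizon u x φ - horizon u y φ| ≤ (lam : ℝ) ^ u.length := by
  induction u generalizing φ with
  | nil =>
    simp only [horizon_nil, List.length_nil, pow_zero]
    exact abs_sub_le_iff.2 ⟨by linarith [(hx φ).2, (hy φ).1], by linarith [(hx φ).1, (hy φ).2]⟩
  | cons σ u ih =>
    rw [horizon_cons, horizon_cons, List.length_cons, pow_succ']
    exact abs_unfold_sub_le σ (pow_nonneg lam.2.1 _) ih φ hφ

/-! ### The value of a formula as the limit of finite-horizon approximations -/

theorem isUnitValued_value (ρ : ℕ → Set AP) : IsUnitValued (fun φ => value φ ρ) := by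
  intro φ
  change 0 ≤ value φ ρ ∧ value φ ρ ≤ 1
  induction φ generalizing ρ with
  | atom b => unfold value; split_ifs <;> simp
  | neg φ ih => unfold value; exact ⟨by linarith [(ih ρ).2], by linarith [(ih ρ).1]⟩
  | disj φ ψ ih₁ ih₂ =>
    unfold value; exact ⟨le_max_of_le_left (ih₁ ρ).1, max_le (ih₁ ρ).2 (ih₂ ρ).2⟩
  | next l φ ih =>
    unfold value
    exact ⟨mul_nonneg l.2.1 (ih _).1, mul_le_one₀ l.2.2.le (ih _).1 (ih _).2⟩
  | untl l φ ψ ih₁ ih₂ =>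
    unfold value
    refine ⟨Real.iSup_nonneg fun i => ?_, Real.iSup_le (fun i => ?_) zero_le_one⟩
    · exact (Finset.le_fold_min _).2 ⟨mul_nonneg (pow_nonneg l.2.1 _) (ih₂ _).1,
        fun j _ => mul_nonneg (pow_nonneg l.2.1 _) (ih₁ _).1⟩
    · exact (Finset.fold_min_le _).2 (Or.inl (mul_le_one₀ (pow_le_one₀ l.2.1 l.2.2.le) (ih₂ _).1 (ih₂ _).2))

/-- The fixed point equation of the discounted until operator. -/
theorem value_untl (l : Discount) (φ ψ : DLTL AP) (ρ : ℕ → Set AP) :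
    value (untl l φ ψ) ρ =
      max (value ψ ρ) (min (value φ ρ) ((l : ℝ) * value (untl l φ ψ) (suffix ρ 1))) := by
  have suff0 : suffix ρ 0 = ρ := by funext n; simp [suffix]
  have suffs : ∀ i, suffix ρ (i + 1) = suffix (suffix ρ 1) i := fun i => by
    funext n; simp [suffix]; congr 1; ring
  have shift : ∀ i : ℕ, (Finset.range (i + 1)).fold min
      ((l : ℝ) ^ (i + 1) * ψ.value (suffix ρ (i + 1))) (fun j => (l : ℝ) ^ j * φ.value (suffix ρ j)) =
      min (value φ ρ) ((l : ℝ) * (Finset.range i).fold min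
        ((l : ℝ) ^ i * ψ.value (suffix (suffix ρ 1) i))
        (fun j => (l : ℝ) ^ j * φ.value (suffix (suffix ρ 1) j))) := by
    intro i
    rw [Finset.range_eq_Ico, ← Finset.insert_Ico_succ_left_eq_Ico (by omega), Finset.fold_insert (by simp),
      pow_zero, one_mul, suff0]
    congr 1
    have : Finset.Ico (Order.succ 0) (i + 1) = (Finset.range i).image Nat.succ := by
      ext j; simp [Finset.mem_image]
      constructor
      · rintro ⟨h1, h2⟩; exact ⟨j - 1, by omega, by omega⟩
      · rintro ⟨k, h1, rfl⟩; omega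
    rw [this, Finset.fold_image (by simp)]
    have hm : ∀ x y : ℝ, (l : ℝ) * min x y = min (l * x) (l * y) := fun x y =>
      mul_min_of_nonneg _ _ l.2.1
    rw [← Finset.fold_hom (op := min) (m := fun x => (l : ℝ) * x) hm]
    rw [suffs, pow_succ', mul_assoc]
    congr 1
    funext j
    change (l : ℝ) ^ (j + 1) * φ.value (suffix ρ (j + 1)) = _
    rw [suffs, pow_succ', mul_assoc]
  set m : (ℕ → Set AP) → ℕ → ℝ := fun ρ i => (Finset.range i).fold min
    ((l : ℝ) ^ i * ψ.value (suffix ρ i)) (fun j => (l : ℝ) ^ j * φ.value (suffix ρ j)) with hm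
  have bdd : ∀ ρ, BddAbove (Set.range (m ρ)) := fun ρ => ⟨1, by
    rintro _ ⟨i, rfl⟩
    exact (Finset.fold_min_le _).2 (Or.inl (mul_le_one₀ (pow_le_one₀ l.2.1 l.2.2.le)
      (isUnitValued_value _ ψ).1 (isUnitValued_value _ ψ).2))⟩
  have hval : ∀ ρ, value (untl l φ ψ) ρ = ⨆ i, m ρ i := fun ρ => rfl
  have hmap : min (value φ ρ) ((l : ℝ) * ⨆ i, m (suffix ρ 1) i) = ⨆ i, m ρ (i + 1) := by
    have hmono : Monotone fun t : ℝ => min (value φ ρ) ((l : ℝ) * t) := fun s t hst =>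
      min_le_min_left _ (mul_le_mul_of_nonneg_left hst l.2.1)
    have := hmono.map_ciSup_of_continuousAt (f := fun t : ℝ => min (value φ ρ) ((l : ℝ) * t))
      (by fun_prop) (bdd (suffix ρ 1))
    rw [this]
    exact iSup_congr fun i => (shift i).symm
  have m0 : m ρ 0 = value ψ ρ := by simp [hm, suff0]
  have bdd' : BddAbove (Set.range fun i => m ρ (i + 1)) := (bdd ρ).mono (by
    rintro _ ⟨i, rfl⟩; exact ⟨i + 1, rfl⟩)
  rw [hval, hval, hmap, ← m0]
  apply le_antisymm
  · refine ciSup_le fun i => ?_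
    cases i with
    | zero => exact le_max_left _ _
    | succ i => exact le_max_of_le_right (le_ciSup bdd' i)
  · exact max_le (le_ciSup (bdd ρ) 0) (ciSup_le fun i => le_ciSup (bdd ρ) (i + 1))

theorem value_eq_unfold (ρ : ℕ → Set AP) :
    (fun φ => value φ ρ) = unfold (ρ 0) (fun φ => value φ (suffix ρ 1)) := by
  funext φ
  induction φ with
  | atom b => rfl
  | neg φ ih => exact congrArg (1 - ·) ih
  | disj φ ψ ih₁ ih₂ => exact congrArg₂ max ih₁ ih₂
  | next l φ ih => rfl
  | untl l φ ψ ih₁ ih₂ =>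
    exact (value_untl l φ ψ ρ).trans (congrArg₂ max ih₂ (congrArg₂ min ih₁ rfl))

/-- The first `n` letters of an infinite word. -/
def pref {α : Type*} (ρ : ℕ → α) (n : ℕ) : List α := (List.range n).map ρ

theorem length_pref {α : Type*} (ρ : ℕ → α) (n : ℕ) : (pref ρ n).length = n := by simp [pref]

theorem pref_succ {α : Type*} (ρ : ℕ → α) (n : ℕ) : pref ρ (n + 1) = pref ρ n ++ [ρ n] := by
  simp [pref, List.range_succ]

theorem value_eq_horizon (ρ : ℕ → Set AP) (n : ℕ) :
    (fun φ => value φ ρ) = horizon (pref ρ n) (fun φ => value φ (suffix ρ n)) := by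
  induction n with
  | zero =>
    have : suffix ρ 0 = ρ := by funext n; simp [suffix]
    simp [pref, horizon_nil, this]
  | succ n ih =>
    rw [ih, pref_succ, horizon_append, value_eq_unfold (suffix ρ n)]
    have : suffix (suffix ρ n) 1 = suffix ρ (n + 1) := by
      funext k; simp [suffix]; congr 1; ring
    rw [this]; rfl

theorem abs_value_sub_horizon_le {lam : Discount} {φ : DLTL AP} (hφ : IsUniform lam φ)
    (ρ : ℕ → Set AP) (n : ℕ) :
    |value φ ρ - horizon (pref ρ n) 0 φ| ≤ (lam : ℝ) ^ n := by
  have h := abs_horizon_sub_le (pref ρ n) (isUnitValued_value (suffix ρ n)) isUnitValued_zero φ hφ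
  rw [← value_eq_horizon, length_pref] at h
  exact h

end DLTL

/-! ### Cardinality of finitely generated lattices -/

theorem exists_finset_supClosure {α : Type*} [SemilatticeSup α] (s : Finset α) :
    ∃ B : Finset α, supClosure (s : Set α) ⊆ B ∧ B.card ≤ 2 ^ s.card := by
  classical
  rcases s.eq_empty_or_nonempty with rfl | ⟨a, -⟩
  · exact ⟨∅, by simp, by simp⟩
  refine ⟨s.powerset.image fun t => if h : t.Nonempty then t.sup' h id else a, ?_, ?_⟩
  · rintro _ ⟨t, ht, hts, rfl⟩
    exact Finset.mem_coe.2 (Finset.mem_image.2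
      ⟨t, Finset.mem_powerset.2 (Finset.coe_subset.1 hts), dif_pos ht⟩)
  · exact Finset.card_image_le.trans (Finset.card_powerset s).le

theorem exists_finset_infClosure {α : Type*} [SemilatticeInf α] (s : Finset α) :
    ∃ B : Finset α, infClosure (s : Set α) ⊆ B ∧ B.card ≤ 2 ^ s.card := by
  classical
  rcases s.eq_empty_or_nonempty with rfl | ⟨a, -⟩
  · exact ⟨∅, by simp, by simp⟩
  refine ⟨s.powerset.image fun t => if h : t.Nonempty then t.inf' h id else a, ?_, ?_⟩
  · rintro _ ⟨t, ht, hts, rfl⟩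
    exact Finset.mem_coe.2 (Finset.mem_image.2
      ⟨t, Finset.mem_powerset.2 (Finset.coe_subset.1 hts), dif_pos ht⟩)
  · exact Finset.card_image_le.trans (Finset.card_powerset s).le

theorem exists_finset_latticeClosure {α : Type*} [DistribLattice α] (s : Finset α) :
    ∃ B : Finset α, latticeClosure (s : Set α) ⊆ B ∧ B.card ≤ 2 ^ 2 ^ s.card := by
  obtain ⟨B, hB, hcB⟩ := exists_finset_infClosure s
  obtain ⟨B', hB', hcB'⟩ := exists_finset_supClosure B
  refine ⟨B', ?_, hcB'.trans (Nat.pow_le_pow_right two_pos hcB)⟩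
  rw [← supClosure_infClosure]
  exact (supClosure_mono hB).trans hB'

/-! ### Signed sums of powers -/

/-- The sums of at most `D` signed powers `± β ^ k`. -/
def signedSums (β : ℝ) : ℕ → Set ℝ
  | 0 => {0}
  | D + 1 => {z | ∃ (ε : SignType) (k : ℕ), ∃ y ∈ signedSums β D, z = ε * β ^ k + y}

namespace signedSums

variable {β : ℝ} {D D' : ℕ} {y z : ℝ}

theorem mem_succ (hz : z ∈ signedSums β D) : z ∈ signedSums β (D + 1) :=
  ⟨0, 0, z, hz, by simp⟩

theorem mono (h : D ≤ D') : signedSums β D ⊆ signedSums β D' := by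
  induction h with
  | refl => exact subset_rfl
  | step _ ih => exact ih.trans fun _ => mem_succ

theorem zero_mem : (0 : ℝ) ∈ signedSums β D := mono (Nat.zero_le D) rfl

theorem neg_mem (hz : z ∈ signedSums β D) : -z ∈ signedSums β D := by
  induction D generalizing z with
  | zero =>
    have : z = 0 := hz
    simpa [this] using zero_mem
  | succ D ih =>
    obtain ⟨ε, k, y, hy, rfl⟩ := hz
    exact ⟨-ε, k, -y, ih hy, by cases ε <;> simp <;> ring⟩

theorem add_mem (hy : y ∈ signedSums β D) (hz : z ∈ signedSums β D') :
    y + z ∈ signedSums β (D + D') := by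
  induction D generalizing y with
  | zero =>
    have : y = 0 := hy
    simpa [this] using hz
  | succ D ih =>
    obtain ⟨ε, k, y, hy, rfl⟩ := hy
    rw [Nat.add_right_comm]
    exact ⟨ε, k, y + z, ih hy, by ring⟩

theorem pow_sub_mem (k : ℕ) (hz : z ∈ signedSums β D) : β ^ k - z ∈ signedSums β (D + 1) :=
  ⟨1, k, -z, neg_mem hz, by simp; ring⟩

theorem pow_mul_mem (j : ℕ) (hz : z ∈ signedSums β D) : β ^ j * z ∈ signedSums β D := by
  induction D generalizing z with
  | zero =>
    have : z = 0 := hz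
    simpa [this] using zero_mem
  | succ D ih =>
    obtain ⟨ε, k, y, hy, rfl⟩ := hz
    exact ⟨ε, j + k, _, ih hy, by ring⟩

/-- The smallest power can be factored out of a signed sum, which leaves a sign plus a shorter signed
sum. -/
theorem exists_factor (hz : z ∈ signedSums β (D + 1)) :
    ∃ (m : ℕ) (ε : SignType), ∃ y ∈ signedSums β D, z = β ^ m * (ε + y) := by
  induction D generalizing z with
  | zero =>
    obtain ⟨ε, k, y, hy, rfl⟩ := hz
    have : y = 0 := hy
    exact ⟨k, ε, 0, rfl, by rw [this]; ring⟩
  | succ D ih =>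
    obtain ⟨ε, k, w, hw, rfl⟩ := hz
    obtain ⟨m, ε', y, hy, rfl⟩ := ih hw
    rcases le_total k m with h | h
    · obtain ⟨j, rfl⟩ := Nat.exists_eq_add_of_le h
      refine ⟨k, ε, β ^ j * (ε' + y), pow_mul_mem j ⟨ε', 0, y, hy, by simp⟩, by ring⟩
    · obtain ⟨j, rfl⟩ := Nat.exists_eq_add_of_le h
      exact ⟨m, ε', ε * β ^ j + y, ⟨ε, j, y, hy, rfl⟩, by ring⟩

theorem abs_sign_le (ε : SignType) : |(ε : ℝ)| ≤ 1 := by cases ε <;> simp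

/-- Only finitely many signed sums with a bounded number of terms lie in a bounded interval: after
factoring out the smallest power `β ^ m`, the cofactor is bounded, hence by induction takes finitely
many values, and then `m` is bounded as well. -/
theorem finite_inter_Icc (hβ : 1 < β) (D : ℕ) (C : ℝ) :
    (signedSums β D ∩ {z | |z| ≤ C}).Finite := by
  induction D generalizing C with
  | zero => exact (Set.finite_singleton 0).subset Set.inter_subset_left
  | succ D ih =>
    have hW := (Set.finite_univ (α := SignType)).image2
      (fun (ε : SignType) (y : ℝ) => (ε : ℝ) + y) (ih (C + 1))
    set W := Set.image2 (fun (ε : SignType) y => (ε : ℝ) + y) Set.univ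
      (signedSums β D ∩ {z | |z| ≤ C + 1})
    have hη : ∃ η > 0, ∀ w ∈ W, w ≠ 0 → η ≤ |w| := by
      rcases (W \ {0}).eq_empty_or_nonempty with h | h
      · refine ⟨1, one_pos, fun w hw h0 => ?_⟩
        exact absurd (show w ∈ W \ {0} from ⟨hw, h0⟩) (by simp [h])
      · obtain ⟨w, hw, hmin⟩ := Set.exists_min_image (W \ {0}) (fun w => |w|) hW.sdiff h
        exact ⟨|w|, abs_pos.2 hw.2, fun v hv h0 => hmin v ⟨hv, h0⟩⟩
    obtain ⟨η, hη, hmin⟩ := hη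
    obtain ⟨M, hM⟩ := pow_unbounded_of_one_lt (C / η) hβ
    refine ((Set.finite_lt_nat M).image2 (fun m w => β ^ m * w) hW |>.insert 0).subset ?_
    rintro z ⟨hz, hzC⟩
    obtain ⟨m, ε, y, hy, rfl⟩ := exists_factor hz
    have h1 : (1 : ℝ) ≤ β ^ m := one_le_pow₀ hβ.le
    have hzC : |β ^ m * (ε + y)| ≤ C := hzC
    rw [abs_mul, abs_of_nonneg (by linarith)] at hzC
    have hw : |(ε : ℝ) + y| ≤ C := by nlinarith [abs_nonneg ((ε : ℝ) + y)]
    have hyC : |y| ≤ C + 1 := by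
      have h2 := abs_le.1 (abs_sign_le ε)
      have h3 := abs_le.1 hw
      exact abs_le.2 ⟨by linarith, by linarith⟩
    by_cases h0 : (ε : ℝ) + y = 0
    · left; rw [h0, mul_zero]
    · right
      have hwW : (ε : ℝ) + y ∈ W := ⟨ε, trivial, y, ⟨hy, hyC⟩, rfl⟩
      refine ⟨m, ?_, _, hwW, rfl⟩
      by_contra hm
      have hm : M ≤ m := not_lt.1 hm
      have h4 := hmin _ hwW h0
      have h5 : β ^ M ≤ β ^ m := pow_le_pow_right₀ hβ.le hm
      rw [div_lt_iff₀ hη] at hM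
      nlinarith [pow_pos (zero_lt_one.trans hβ) m]

end signedSums

/-- An exponent `N` such that `a ^ N` is a common denominator of the signed sums of at most `D`
powers of `b / a` that lie in `[-C, C]`, provided that `C + D ≤ c₀`. -/
def denomExp (a c₀ : ℕ) : ℕ → ℕ
  | 0 => 0
  | D + 1 => denomExp a c₀ D + a * c₀ * a ^ denomExp a c₀ D

/-- The quantitative form of `signedSums.finite_inter_Icc` for a rational base. -/
theorem signedSums.exists_int {a b c₀ : ℕ} (ha : 0 < a) (hab : a < b) {D C : ℕ} (hc : C + D ≤ c₀)
    {z : ℝ} (hz : z ∈ signedSums ((b : ℝ) / a) D) (hzC : |z| ≤ C) :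
    ∃ j : ℤ, z * (a : ℝ) ^ denomExp a c₀ D = j := by
  have ha' : (0 : ℝ) < a := by exact_mod_cast ha
  induction D generalizing C z with
  | zero =>
    have : z = 0 := hz
    exact ⟨0, by simp [this]⟩
  | succ D ih =>
    obtain ⟨m, ε, y, hy, rfl⟩ := exists_factor hz
    set N := denomExp a c₀ D with hN
    have hβ : 1 + (1 : ℝ) / a ≤ (b : ℝ) / a := by
      rw [le_div_iff₀ ha', add_mul, one_mul, one_div_mul_cancel ha'.ne']
      exact_mod_cast hab
    have hinv : 0 < (1 : ℝ) / a := by positivity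
    have hβ1 : 1 ≤ (b : ℝ) / a := by linarith
    have h1 : (1 : ℝ) ≤ ((b : ℝ) / a) ^ m := one_le_pow₀ hβ1
    rw [abs_mul, abs_of_nonneg (by linarith)] at hzC
    have hw : |(ε : ℝ) + y| ≤ C := by nlinarith [abs_nonneg ((ε : ℝ) + y)]
    have hyC : |y| ≤ ((C + 1 : ℕ) : ℝ) := by
      have h2 := abs_le.1 (abs_sign_le ε)
      have h3 := abs_le.1 hw
      push_cast
      exact abs_le.2 ⟨by linarith, by linarith⟩
    obtain ⟨j, hj⟩ := ih (C := C + 1) (by omega) hy hyC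
    have hw' : ∃ i : ℤ, ((ε : ℝ) + y) * (a : ℝ) ^ N = i :=
      ⟨(ε : ℤ) * (a : ℤ) ^ N + j, by push_cast; rw [← hj]; cases ε <;> simp <;> ring⟩
    obtain ⟨i, hi⟩ := hw'
    by_cases h0 : i = 0
    · refine ⟨0, ?_⟩
      have : (ε : ℝ) + y = 0 := by
        rw [h0, Int.cast_zero] at hi
        exact (mul_eq_zero.1 hi).resolve_right (by positivity)
      rw [this]; simp
    have hm : m ≤ a * c₀ * a ^ N := by
      have h6 : 1 ≤ |(ε : ℝ) + y| * (a : ℝ) ^ N := by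
        rw [← abs_of_pos (pow_pos ha' N), ← abs_mul, hi, ← Int.cast_abs]
        exact_mod_cast Int.one_le_abs h0
      have h7 : ((b : ℝ) / a) ^ m ≤ C * (a : ℝ) ^ N := by
        calc ((b : ℝ) / a) ^ m ≤ ((b : ℝ) / a) ^ m * (|(ε : ℝ) + y| * (a : ℝ) ^ N) :=
              le_mul_of_one_le_right (by linarith) h6
          _ = ((b : ℝ) / a) ^ m * |(ε : ℝ) + y| * (a : ℝ) ^ N := by ring
          _ ≤ C * (a : ℝ) ^ N := by gcongr
      have h8 : 1 + (m : ℝ) * (1 / a) ≤ ((b : ℝ) / a) ^ m :=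
        (one_add_mul_le_pow (by linarith) m).trans (pow_le_pow_left₀ (by linarith) hβ m)
      have h9 : (m : ℝ) * (1 / a) ≤ c₀ * (a : ℝ) ^ N := by
        have : (C : ℝ) ≤ c₀ := by exact_mod_cast (by omega : C ≤ c₀)
        have : (C : ℝ) * (a : ℝ) ^ N ≤ c₀ * (a : ℝ) ^ N := by gcongr
        linarith
      rw [mul_one_div, div_le_iff₀ ha'] at h9
      have : (m : ℝ) ≤ ((a * c₀ * a ^ N : ℕ) : ℝ) := by push_cast; linarith
      exact_mod_cast this
    obtain ⟨k, hk⟩ := Nat.exists_eq_add_of_le hm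
    refine ⟨(b : ℤ) ^ m * (a : ℤ) ^ k * i, ?_⟩
    rw [denomExp, ← hN, hk, div_pow]
    push_cast
    rw [← hi]
    have : (a : ℝ) ^ m ≠ 0 := by positivity
    field_simp
    ring

theorem exists_finset_signedSums {a b : ℕ} (ha : 0 < a) (hab : a < b) (D : ℕ) :
    ∃ Z : Finset ℝ, (∀ z ∈ signedSums ((b : ℝ) / a) D, |z| ≤ 2 → z ∈ Z) ∧
      Z.card ≤ 4 * a ^ denomExp a (D + 2) D + 1 := by
  classical
  have ha' : (0 : ℝ) < a := by exact_mod_cast ha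
  set N := denomExp a (D + 2) D with hN
  refine ⟨(Finset.Icc (-(2 * a ^ N) : ℤ) (2 * a ^ N)).image fun j : ℤ => (j : ℝ) / a ^ N,
    fun z hz hz2 => ?_, ?_⟩
  · obtain ⟨j, hj⟩ := signedSums.exists_int (C := 2) (c₀ := D + 2) ha hab (by omega) hz
      (by exact_mod_cast hz2)
    rw [← hN] at hj
    have hp : (0 : ℝ) < (a : ℝ) ^ N := by positivity
    refine Finset.mem_image.2 ⟨j, Finset.mem_Icc.2 (abs_le.1 ?_), ?_⟩
    · have : |(j : ℝ)| ≤ 2 * (a : ℝ) ^ N := by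
        rw [← hj, abs_mul, abs_of_pos hp]; gcongr
      exact_mod_cast this
    · rw [← hj]; field_simp
  · refine Finset.card_image_le.trans ?_
    have : ((a ^ N : ℕ) : ℤ) = (a : ℤ) ^ N := by push_cast; rfl
    rw [Int.card_Icc, ← this]
    omega

/-! ### Finitely many residuals -/

namespace DLTL

variable {AP : Type*}

/-- The list of all subformulas, with repetitions. -/
def subs : DLTL AP → List (DLTL AP)
  | atom b => [atom b]
  | neg φ => neg φ :: φ.subs
  | disj φ ψ => disj φ ψ :: (φ.subs ++ ψ.subs)
  | next l φ => next l φ :: φ.subs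
  | untl l φ ψ => untl l φ ψ :: (φ.subs ++ ψ.subs)

theorem self_mem_subs (φ : DLTL AP) : φ ∈ φ.subs := by cases φ <;> simp [subs]

theorem length_tokens {k : ℕ} (φ : DLTL (Fin k)) : φ.tokens.length = φ.subs.length := by
  induction φ <;> simp_all [tokens, subs]

/-- The functions `x ↦ γ + ε * x ψ` of a valuation `x` with `γ` a signed sum of at most `D` powers
of `β`, `ε` a sign, and `ψ` from the list `l`. -/
def affineTerms (β : ℝ) (D : ℕ) (l : List (DLTL AP)) : Set (Valuation AP → ℝ) :=
  {f | ∃ γ ∈ signedSums β D, ∃ (ε : SignType), ∃ ψ ∈ l, f = fun x => γ + ε * x.1 ψ}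

theorem affineTerms_mono {β : ℝ} {D D' : ℕ} {l l' : List (DLTL AP)} (hD : D ≤ D') (hl : l ⊆ l') :
    affineTerms β D l ⊆ affineTerms β D' l' := by
  rintro _ ⟨γ, hγ, ε, ψ, hψ, rfl⟩
  exact ⟨γ, signedSums.mono hD hγ, ε, ψ, hl hψ, rfl⟩

theorem pow_sub_mem_latticeClosure {β : ℝ} {D : ℕ} {l : List (DLTL AP)} (n : ℕ)
    {f : Valuation AP → ℝ} (hf : f ∈ latticeClosure (affineTerms β D l)) :
    (fun x => β ^ n - f x) ∈ latticeClosure (affineTerms β (D + 1) l) := by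
  have h := Set.mem_image_of_mem (fun (g : Valuation AP → ℝ) x => β ^ n - g x) hf
  rw [image_latticeClosure' _ _ (fun a b => by
      funext x; exact (min_sub_sub_left (β ^ n) (a x) (b x)).symm) (fun a b => by
      funext x; exact (max_sub_sub_left (β ^ n) (a x) (b x)).symm)] at h
  refine latticeClosure_mono ?_ h
  rintro _ ⟨_, ⟨γ, hγ, ε, ψ, hψ, rfl⟩, rfl⟩
  refine ⟨β ^ n - γ, signedSums.pow_sub_mem n hγ, -ε, ψ, hψ, ?_⟩
  funext x
  cases ε <;> simp <;> ring

/-- Scaled by `λ ^ (-|u|)`, the value on `u · ρ` is a lattice polynomial in affine functions of the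
values on `ρ` with slopes `0, ±1`. Scaling makes the temporal operators invisible, so that only a
negation enlarges the set of constant parts. -/
theorem scaled_horizon_mem_latticeClosure {lam : Discount} (hlam : (lam : ℝ) ≠ 0) (φ : DLTL AP)
    (hφ : IsUniform lam φ) (u : List (Set AP)) :
    (fun x : Valuation AP => ((lam : ℝ)⁻¹) ^ u.length * horizon u x.1 φ) ∈
      latticeClosure (affineTerms (lam : ℝ)⁻¹ φ.subs.length φ.subs) := by
  set β := (lam : ℝ)⁻¹ with hβ
  have hβ0 : ∀ n, 0 ≤ β ^ n := fun n => pow_nonneg (inv_nonneg.2 lam.2.1) n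
  have hnil : ∀ φ : DLTL AP, (fun x : Valuation AP =>
      β ^ ([] : List (Set AP)).length * horizon [] x.1 φ) ∈
      latticeClosure (affineTerms β φ.subs.length φ.subs) := fun φ =>
    subset_latticeClosure ⟨0, signedSums.zero_mem, 1, φ, φ.self_mem_subs, by
      funext x; simp [horizon_nil]⟩
  have hshift : ∀ (n : ℕ) (t : ℝ), β ^ (n + 1) * ((lam : ℝ) * t) = β ^ n * t := fun n t => by
    rw [pow_succ, mul_assoc, ← mul_assoc β, hβ, inv_mul_cancel₀ hlam, one_mul]
  have hsup : ∀ {s : Set (Valuation AP → ℝ)} {f g}, f ∈ latticeClosure s →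
      g ∈ latticeClosure s → (fun x => max (f x) (g x)) ∈ latticeClosure s := fun hf hg =>
    isSublattice_latticeClosure.supClosed hf hg
  have hinf : ∀ {s : Set (Valuation AP → ℝ)} {f g}, f ∈ latticeClosure s →
      g ∈ latticeClosure s → (fun x => min (f x) (g x)) ∈ latticeClosure s := fun hf hg =>
    isSublattice_latticeClosure.infClosed hf hg
  induction φ generalizing u with
  | atom b =>
    cases u with
    | nil => exact hnil _
    | cons σ u =>
      by_cases h : b ∈ σ
      · exact subset_latticeClosure ⟨β ^ (u.length + 1), ⟨1, u.length + 1, 0, rfl, by simp⟩, 0, atom b,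
          self_mem_subs _, by funext x; simp [horizon_cons, unfold, h]⟩
      · exact subset_latticeClosure ⟨0, signedSums.zero_mem, 0, atom b,
          self_mem_subs _, by funext x; simp [horizon_cons, unfold, h]⟩
  | neg φ ih =>
    cases u with
    | nil => exact hnil _
    | cons σ u =>
      have h := pow_sub_mem_latticeClosure (σ :: u).length (ih hφ (σ :: u))
      refine latticeClosure_mono (affineTerms_mono (D := φ.subs.length + 1) le_rfl
        (List.subset_cons_self _ _)) ?_
      convert h using 1
      funext x
      simp only [horizon_cons, unfold]; ring
  | disj φ ψ ih₁ ih₂ =>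
    cases u with
    | nil => exact hnil _
    | cons σ u =>
      have h := hsup (latticeClosure_mono (affineTerms_mono (D' := (disj φ ψ).subs.length)
          (l' := (disj φ ψ).subs) (by simp [subs]; omega) (by simp [subs])) (ih₁ hφ.1 (σ :: u)))
        (latticeClosure_mono (affineTerms_mono (by simp [subs]; omega) (by simp [subs]))
          (ih₂ hφ.2 (σ :: u)))
      convert h using 1
      funext x
      simp only [horizon_cons, unfold]
      rw [mul_max_of_nonneg _ _ (hβ0 _)]
  | next l φ ih =>
    obtain ⟨rfl, hφ⟩ := hφ
    cases u with
    | nil => exact hnil _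
    | cons σ u =>
      have h := ih hφ u
      refine latticeClosure_mono (affineTerms_mono (Nat.le_succ _) (List.subset_cons_self _ _)) ?_
      convert h using 1
      funext x
      simp only [horizon_cons, unfold, List.length_cons, hshift]
  | untl l φ ψ ih₁ ih₂ =>
    obtain ⟨rfl, hφ, hψ⟩ := hφ
    induction u with
    | nil => exact hnil _
    | cons σ u ih =>
      have h := hsup (latticeClosure_mono (affineTerms_mono (D' := (untl l φ ψ).subs.length)
          (l' := (untl l φ ψ).subs) (by simp [subs]; omega) (by simp [subs])) (ih₂ hψ (σ :: u)))
        (hinf (latticeClosure_mono (affineTerms_mono (by simp [subs]; omega) (by simp [subs]))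
          (ih₁ hφ (σ :: u))) ih)
      convert h using 1
      funext x
      simp only [horizon_cons, unfold, List.length_cons]
      rw [mul_max_of_nonneg _ _ (hβ0 _), mul_min_of_nonneg _ _ (hβ0 _), hshift]

/-- The residual of a formula after the finite word `u`: the value on `u · ρ` as a function of the
values on `ρ`, normalized to be `0` at `0` and to have oscillation at most `1`. For the discount factor
`0` and nonempty `u` the division by zero makes it the zero function. -/
noncomputable def residual (lam : Discount) (φ : DLTL AP) (u : List (Set AP)) :
    Valuation AP → ℝ :=
  fun x => (horizon u x.1 φ - horizon u 0 φ) / (lam : ℝ) ^ u.length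

theorem abs_residual_le {lam : Discount} {φ : DLTL AP} (hφ : IsUniform lam φ)
    (u : List (Set AP)) (x : Valuation AP) : |residual lam φ u x| ≤ 1 := by
  have h := abs_horizon_sub_le u x.2 isUnitValued_zero φ hφ
  have h0 : 0 ≤ (lam : ℝ) ^ u.length := pow_nonneg lam.2.1 _
  rw [residual, abs_div, abs_of_nonneg h0]
  exact div_le_one_of_le₀ h h0

/-- The affine functions truncated to `[-1, 1]`, with constant parts from the finite set `Z`,
together with the two constants `± 1`. -/
noncomputable def clampedTerms (Z : Finset ℝ) (l : List (DLTL AP)) :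
    Finset (Valuation AP → ℝ) := by
  classical exact
    ((Z ×ˢ (Finset.univ : Finset SignType) ×ˢ l.toFinset).image fun t x =>
      max (-1) (min 1 (t.1 + t.2.1 * x.1 t.2.2))) ∪ {fun _ => 1, fun _ => -1}

theorem card_clampedTerms_le (Z : Finset ℝ) (l : List (DLTL AP)) :
    (clampedTerms Z l).card ≤ Z.card * (3 * l.length) + 2 := by
  classical
  unfold clampedTerms
  refine (Finset.card_union_le _ _).trans (Nat.add_le_add ?_ Finset.card_le_two)
  refine Finset.card_image_le.trans ?_
  rw [Finset.card_product, Finset.card_product]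
  have : (Finset.univ : Finset SignType).card = 3 := rfl
  rw [this]
  gcongr
  exact l.toFinset_card_le

/-- All residuals of a formula lie in one finitely generated, hence finite, lattice of functions. -/
theorem residual_mem_latticeClosure {lam : Discount} (hlam : (lam : ℝ) ≠ 0) {φ : DLTL AP}
    (hφ : IsUniform lam φ) {Z : Finset ℝ}
    (hZ : ∀ z ∈ signedSums (lam : ℝ)⁻¹ (2 * φ.subs.length), |z| ≤ 2 → z ∈ Z) (u : List (Set AP)) :
    residual lam φ u ∈ latticeClosure (clampedTerms Z φ.subs : Set _) := by
  classical
  have hf := scaled_horizon_mem_latticeClosure hlam φ hφ u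
  set f := fun x : Valuation AP =>
    ((lam : ℝ)⁻¹) ^ u.length * horizon u x.1 φ with hfdef
  set z0 : Valuation AP := ⟨0, isUnitValued_zero⟩
  have hℓ : f z0 ∈ signedSums (lam : ℝ)⁻¹ φ.subs.length := by
    have hmin := latticeClosure_min (s := affineTerms (lam : ℝ)⁻¹ φ.subs.length φ.subs)
      (t := {g | g z0 ∈ signedSums (lam : ℝ)⁻¹ φ.subs.length}) ?_ ⟨?_, ?_⟩
    · exact hmin hf
    · rintro _ ⟨γ, hγ, ε, ψ, hψ, rfl⟩
      simpa [z0] using hγ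
    · intro g hg h hh
      change max (g z0) (h z0) ∈ signedSums (lam : ℝ)⁻¹ φ.subs.length
      rcases max_choice (g z0) (h z0) with e | e <;> rw [e] <;> assumption
    · intro g hg h hh
      change min (g z0) (h z0) ∈ signedSums (lam : ℝ)⁻¹ φ.subs.length
      rcases min_choice (g z0) (h z0) with e | e <;> rw [e] <;> assumption
  have hres : residual lam φ u = fun x => max (-1) (min 1 (f x - f z0)) := by
    funext x
    have h1 : f x - f z0 = residual lam φ u x := by
      simp only [hfdef, residual, z0, inv_pow]
      field_simp
    have h2 := abs_le.1 (abs_residual_le hφ u x)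
    rw [h1, min_eq_right h2.2, max_eq_right h2.1]
  rw [hres]
  have h := Set.mem_image_of_mem
    (fun (g : Valuation AP → ℝ) x => max (-1) (min 1 (g x - f z0))) hf
  have hmono : Monotone fun t : ℝ => max (-1) (min 1 (t - f z0)) := fun s t hst =>
    max_le_max_left _ (min_le_min_left _ (sub_le_sub_right hst _))
  rw [image_latticeClosure _ _ (fun a b => by funext x; exact hmono.map_max)
    (fun a b => by funext x; exact hmono.map_min)] at h
  refine latticeClosure_mono ?_ h
  rintro _ ⟨_, ⟨γ, hγ, ε, ψ, hψ, rfl⟩, rfl⟩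
  have hdiff : γ - f z0 ∈ signedSums (lam : ℝ)⁻¹ (2 * φ.subs.length) := by
    rw [two_mul, sub_eq_add_neg]
    exact signedSums.add_mem hγ (signedSums.neg_mem hℓ)
  have hε : ∀ x : Valuation AP, |(ε : ℝ) * x.1 ψ| ≤ 1 := fun x => by
    rw [abs_mul, abs_of_nonneg (x.2 ψ).1]
    exact mul_le_one₀ (signedSums.abs_sign_le ε) (x.2 ψ).1 (x.2 ψ).2
  unfold clampedTerms
  rw [Finset.mem_coe, Finset.mem_union]
  by_cases hγ2 : |γ - f z0| ≤ 2
  · left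
    refine Finset.mem_image.2 ⟨(γ - f z0, ε, ψ), by simp [hZ _ hdiff hγ2, hψ], ?_⟩
    funext x
    simp only
    congr 2
    ring
  · right
    rw [Finset.mem_insert, Finset.mem_singleton]
    rcases lt_abs.1 (not_le.1 hγ2) with h2 | h2
    · left
      funext x
      have := abs_le.1 (hε x)
      simp only
      rw [min_eq_left (by linarith), max_eq_right (by norm_num)]
    · right
      funext x
      have := abs_le.1 (hε x)
      simp only
      rw [min_eq_right (by linarith), max_eq_left (by linarith)]

theorem finite_range_residual {lam : Discount} (hlam : (lam : ℝ) ≠ 0) {φ : DLTL AP}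
    (hφ : IsUniform lam φ) : (Set.range (residual lam φ)).Finite := by
  have h0 : 0 < (lam : ℝ) := lt_of_le_of_ne lam.2.1 (Ne.symm hlam)
  have hZ := signedSums.finite_inter_Icc ((one_lt_inv₀ h0).2 lam.2.2) (2 * φ.subs.length) 2
  refine ((clampedTerms hZ.toFinset φ.subs).finite_toSet.latticeClosure).subset ?_
  rintro _ ⟨u, rfl⟩
  exact residual_mem_latticeClosure hlam hφ (fun z hz hz2 => by simp [hz, hz2]) u

/-- An explicit bound for the number of residuals of a formula with `len` subformulas and a discount
factor with numerator `a`. -/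
def residualBound (a len : ℕ) : ℕ :=
  2 ^ 2 ^ ((4 * a ^ denomExp a (2 * len + 2) (2 * len) + 1) * (3 * len) + 2)

theorem exists_finset_residual {lam : Discount} {a b : ℕ} (ha : 0 < a) (hab : a < b)
    (hlam : (lam : ℝ) = (a : ℝ) / b) {φ : DLTL AP} (hφ : IsUniform lam φ) :
    ∃ B : Finset (Valuation AP → ℝ),
      (∀ u, residual lam φ u ∈ B) ∧ B.card ≤ residualBound a φ.subs.length := by
  have ha' : (0 : ℝ) < a := by exact_mod_cast ha
  have hb' : (0 : ℝ) < b := by exact_mod_cast ha.trans hab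
  obtain ⟨Z, hZ, hcZ⟩ := exists_finset_signedSums ha hab (2 * φ.subs.length)
  obtain ⟨B, hB, hcB⟩ := exists_finset_latticeClosure (clampedTerms Z φ.subs)
  have hlam0 : (lam : ℝ) ≠ 0 := by rw [hlam]; positivity
  refine ⟨B, fun u => hB (residual_mem_latticeClosure hlam0 hφ ?_ u), hcB.trans ?_⟩
  · rw [hlam, inv_div]; exact hZ
  · unfold residualBound
    gcongr
    · norm_num
    · norm_num
    · exact (card_clampedTerms_le _ _).trans (by gcongr)

end DLTL

/-! ### Reward machines -/

/-- A function of finite words whose value after one more letter depends only on its present value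
has this property for longer extensions as well. -/
theorem append_congr_of_concat {S X : Type*} {g : List S → X}
    (hg : ∀ u v s, g u = g v → g (u ++ [s]) = g (v ++ [s])) {u v : List S} (h : g u = g v)
    (z : List S) : g (u ++ z) = g (v ++ z) := by
  induction z generalizing u v with
  | nil => simpa using h
  | cons s z ih => simpa using ih (hg u v s h)

/-- The pumping argument: every word can be replaced by one that is shorter than the number of values
of `g`. -/
theorem exists_short_word {S X : Type*} {g : List S → X}
    (hg : ∀ u v s, g u = g v → g (u ++ [s]) = g (v ++ [s])) {B : Finset X} (hB : ∀ w, g w ∈ B)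
    (w : List S) : ∃ w' : List S, w'.length < B.card ∧ g w' = g w := by
  induction hn : w.length using Nat.strong_induction_on generalizing w with
  | _ n ih =>
    subst hn
    by_cases hlt : w.length < B.card
    · exact ⟨w, hlt, rfl⟩
    obtain ⟨i, hi, j, hj, hij, he⟩ := Finset.exists_ne_map_eq_of_card_lt_of_maps_to
      (s := Finset.range (w.length + 1)) (t := B) (f := fun i => g (w.take i))
      (by rw [Finset.card_range]; omega) (fun i _ => hB _)
    wlog hlt' : i < j generalizing i j
    · exact this j hj i hi hij.symm he.symm (by omega)
    rw [Finset.mem_range] at hi hj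
    have h1 := append_congr_of_concat hg he (w.drop j)
    rw [List.take_append_drop] at h1
    obtain ⟨w', hw', e⟩ := ih (w.take i ++ w.drop j).length
      (by simp only [List.length_append, List.length_take, List.length_drop]; omega) _ rfl
    exact ⟨w', hw', e.trans h1⟩

/-- A function of finite words with finitely many values, whose value after one more letter depends
only on its present value, is computed by a finite automaton. -/
theorem exists_automaton {S X : Type*} {g : List S → X}
    (hg : ∀ u v s, g u = g v → g (u ++ [s]) = g (v ++ [s])) (hfin : (Set.range g).Finite) :
    ∃ (c : ℕ) (δ : Fin c → S → Fin c) (q₀ : Fin c) (out : Fin c → X),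
      (∀ w : List S, out (w.foldl δ q₀) = g w) ∧ ∀ q, ∃ w, out q = g w := by
  have := hfin.to_subtype
  obtain ⟨c, ⟨e⟩⟩ := Finite.exists_equiv_fin (Set.range g)
  have hrep : ∀ q : Fin c, ∃ w, g w = (e.symm q : X) := fun q => (e.symm q).2
  choose rep hrep using hrep
  refine ⟨c, fun q s => e ⟨g (rep q ++ [s]), _, rfl⟩, e ⟨g [], _, rfl⟩, fun q => e.symm q,
    fun w => ?_, fun q => ⟨rep q, (hrep q).symm⟩⟩
  induction w using List.reverseRecOn with
  | nil => simp
  | append_singleton w s ih =>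
    rw [List.foldl_append, List.foldl_cons, List.foldl_nil]
    simp only [Equiv.symm_apply_apply]
    exact hg _ _ s ((hrep _).trans ih)

namespace DLTL

variable {AP S Q : Type*}

theorem horizon_concat (u : List (Set AP)) (σ : Set AP) (x : DLTL AP → ℝ) :
    horizon (u ++ [σ]) x = horizon u (unfold σ x) := horizon_append u [σ] x

theorem residual_concat (lam : Discount) (φ : DLTL AP) (u : List (Set AP)) (σ : Set AP)
    (x : Valuation AP) :
    residual lam φ (u ++ [σ]) x = (residual lam φ u ⟨unfold σ x.1, isUnitValued_unfold σ x.2⟩ -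
      residual lam φ u ⟨unfold σ 0, isUnitValued_unfold σ isUnitValued_zero⟩) / lam := by
  simp only [residual, horizon_concat, List.length_append, List.length_singleton, pow_succ]
  rw [← sub_div, div_div]
  ring

/-- The deterministic automaton with transition function `δ`, initial state `q₀` and rewards `r`
computes the increments of the finite-horizon values of `φ`, so that the value of `φ` on a word is
the discounted sum of the rewards. -/
def IsRewardMachine (L : S → Set AP) (lam : Discount) (φ : DLTL AP) (δ : Q → S → Q) (q₀ : Q)
    (r : Q → S → ℝ) : Prop :=
  ∀ (w : List S) (s : S), (lam : ℝ) ^ w.length * r (w.foldl δ q₀) s =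
    horizon ((w ++ [s]).map L) 0 φ - horizon (w.map L) 0 φ

theorem pow_mul_residual {lam : Discount} (hlam : (lam : ℝ) ≠ 0) (L : S → Set AP) (φ : DLTL AP)
    (w : List S) (s : S) :
    (lam : ℝ) ^ w.length *
      residual lam φ (w.map L) ⟨unfold (L s) 0, isUnitValued_unfold (L s) isUnitValued_zero⟩ =
    horizon ((w ++ [s]).map L) 0 φ - horizon (w.map L) 0 φ := by
  rw [List.map_append, List.map_singleton, horizon_concat, residual, List.length_map,
    mul_div_cancel₀ _ (pow_ne_zero _ hlam)]

/-- Equality of residuals is a right congruence on words. -/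
theorem residual_map_congr (L : S → Set AP) (lam : Discount) (φ : DLTL AP) (u v : List S) (s : S)
    (h : residual lam φ (u.map L) = residual lam φ (v.map L)) :
    residual lam φ ((u ++ [s]).map L) = residual lam φ ((v ++ [s]).map L) := by
  funext x
  rw [List.map_append, List.map_append, List.map_singleton, residual_concat, residual_concat, h]

theorem horizon_concat_eq_of_zero {lam : Discount} (hlam : (lam : ℝ) = 0) {φ : DLTL AP}
    (hφ : IsUniform lam φ) (L : S → Set AP) {w : List S} (hw : w ≠ []) (s : S) :
    horizon ((w ++ [s]).map L) 0 φ = horizon (w.map L) 0 φ := by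
  rw [List.map_append, List.map_singleton, horizon_concat]
  have h := abs_horizon_sub_le (w.map L) (isUnitValued_unfold (L s) isUnitValued_zero) isUnitValued_zero φ hφ
  rw [hlam, List.length_map, zero_pow (by simpa using hw)] at h
  exact sub_eq_zero.1 (abs_nonpos_iff.1 h)

/-- Every uniformly discounted formula has a finite reward machine; its states are the residuals. -/
theorem exists_isRewardMachine (L : S → Set AP) {lam : Discount} {φ : DLTL AP}
    (hφ : IsUniform lam φ) :
    ∃ (c : ℕ) (δ : Fin c → S → Fin c) (q₀ : Fin c) (r : Fin c → S → ℝ),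
      IsRewardMachine L lam φ δ q₀ r ∧ ∀ q s, ∃ w : List S, r q s =
        residual lam φ (w.map L) ⟨unfold (L s) 0, isUnitValued_unfold (L s) isUnitValued_zero⟩ := by
  by_cases h0 : (lam : ℝ) = 0
  · -- only the first letter matters, so that one state suffices
    refine ⟨1, fun q _ => q, 0, fun _ s => residual lam φ []
      ⟨unfold (L s) 0, isUnitValued_unfold (L s) isUnitValued_zero⟩, fun w s => ?_, fun _ _ => ⟨[], rfl⟩⟩
    by_cases hw : w = []
    · simp [hw, residual, horizon]
    · rw [horizon_concat_eq_of_zero h0 hφ L hw, h0, zero_pow (by simpa using hw)]; simp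
  · have hfin : (Set.range fun w : List S => residual lam φ (w.map L)).Finite :=
      (finite_range_residual h0 hφ).subset (by rintro _ ⟨w, rfl⟩; exact ⟨_, rfl⟩)
    obtain ⟨c, δ, q₀, out, hout, hrange⟩ :=
      exists_automaton (residual_map_congr L lam φ) hfin
    refine ⟨c, δ, q₀, fun q s => out q ⟨unfold (L s) 0, isUnitValued_unfold (L s) isUnitValued_zero⟩,
      fun w s => ?_, fun q s => ?_⟩
    · beta_reduce
      rw [hout, pow_mul_residual h0]
    · obtain ⟨w, hw⟩ := hrange q
      exact ⟨w, congrFun hw _⟩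

/-- A candidate for a reward machine can be checked on words of bounded length: the state of the
candidate together with the residual takes at most `c * residualBound` values. -/
theorem isRewardMachine_of_bounded {L : S → Set AP} {lam : Discount} {a b c : ℕ} (hab : a < b)
    (hlam : (lam : ℝ) = (a : ℝ) / b) {φ : DLTL AP} (hφ : IsUniform lam φ) {δ : Fin c → S → Fin c}
    {q₀ : Fin c} {r : Fin c → S → ℝ}
    (h : ∀ w : List S, w.length ≤ c * residualBound a φ.subs.length → ∀ s,
      (lam : ℝ) ^ w.length * r (w.foldl δ q₀) s =
        horizon ((w ++ [s]).map L) 0 φ - horizon (w.map L) 0 φ) :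
    IsRewardMachine L lam φ δ q₀ r := by
  intro w s
  rcases Nat.eq_zero_or_pos a with rfl | ha
  · have h0 : (lam : ℝ) = 0 := by simpa using hlam
    by_cases hw : w = []
    · exact h w (by simp [hw]) s
    · rw [horizon_concat_eq_of_zero h0 hφ L hw, h0, zero_pow (by simpa using hw)]; simp
  have h0 : (lam : ℝ) ≠ 0 := by
    have : (0 : ℝ) < a := by exact_mod_cast ha
    have : (0 : ℝ) < b := by exact_mod_cast ha.trans hab
    rw [hlam]; positivity
  obtain ⟨B, hB, hcB⟩ := exists_finset_residual ha hab hlam hφ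
  -- the state of the candidate and the residual together determine whether the equation holds
  obtain ⟨w', hw', e⟩ := exists_short_word
    (g := fun w : List S => (w.foldl δ q₀, residual lam φ (w.map L)))
    (B := Finset.univ ×ˢ B) (fun u v s huv => by
      simp only [Prod.mk.injEq] at huv ⊢
      exact ⟨by rw [List.foldl_append, List.foldl_append, huv.1],
        residual_map_congr L lam φ u v s huv.2⟩)
    (fun w => by simp [hB]) w
  simp only [Prod.mk.injEq] at e
  rw [Finset.card_product, Finset.card_univ, Fintype.card_fin] at hw'
  have h1 := h w' (hw'.le.trans (Nat.mul_le_mul_left _ hcB)) s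
  rw [← pow_mul_residual h0] at h1
  rw [← pow_mul_residual h0, ← e.1, ← e.2, mul_left_cancel₀ (pow_ne_zero _ h0) h1]

theorem sum_rewards {L : S → Set AP} {lam : Discount} {φ : DLTL AP} {δ : Q → S → Q} {q₀ : Q}
    {r : Q → S → ℝ} (h : IsRewardMachine L lam φ δ q₀ r) (ρ : ℕ → S) (T : ℕ) :
    ∑ t ∈ Finset.range T, (lam : ℝ) ^ t * r ((pref ρ t).foldl δ q₀) (ρ t) =
      horizon ((pref ρ T).map L) 0 φ := by
  induction T with
  | zero => simp [pref, horizon_nil]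
  | succ T ih =>
    have := h (pref ρ T) (ρ T)
    rw [length_pref] at this
    rw [Finset.sum_range_succ, ih, this, pref_succ]
    ring

theorem abs_value_sub_sum_rewards_le {L : S → Set AP} {lam : Discount} {φ : DLTL AP}
    (hφ : IsUniform lam φ) {δ : Q → S → Q} {q₀ : Q} {r : Q → S → ℝ}
    (h : IsRewardMachine L lam φ δ q₀ r) (ρ : ℕ → S) (T : ℕ) :
    |value φ (fun n => L (ρ n)) -
      ∑ t ∈ Finset.range T, (lam : ℝ) ^ t * r ((pref ρ t).foldl δ q₀) (ρ t)| ≤ (lam : ℝ) ^ T := by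
  have h1 : (pref ρ T).map L = pref (fun n => L (ρ n)) T := by simp [pref]
  rw [sum_rewards h, h1]
  exact abs_value_sub_horizon_le hφ _ T

end DLTL

/-! ### Verification of a policy by the Bellman equation -/

namespace MDP

open DLTL (pref length_pref pref_succ)

theorem history_frestrictLe {S A : Type*} (ψ : ℕ → S × A) (n : ℕ) :
    history (Preorder.frestrictLe (π := fun _ => S × A) n ψ) = pref ψ (n + 1) := by
  unfold history pref
  refine List.ext_getElem (by rw [List.length_ofFn, List.length_map, List.length_range])
    fun i h₁ h₂ => ?_
  rw [List.getElem_ofFn, List.getElem_map, List.getElem_range]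
  rfl

variable {S A : Type*} [Fintype S] [MeasurableSpace S] [MeasurableSingletonClass S]
  [Fintype A] [MeasurableSpace A] [MeasurableSingletonClass A]

theorem measurable_pref {β : Type*} [MeasurableSpace β] (H : List (S × A) → β) (n : ℕ) :
    Measurable fun ψ : ℕ → S × A => H (pref ψ n) := by
  cases n with
  | zero => exact measurable_const (a := H [])
  | succ n =>
    have : (fun ψ : ℕ → S × A => H (pref ψ (n + 1))) =
        (fun x => H (history x)) ∘ Preorder.frestrictLe (π := fun _ => S × A) n := by
      funext ψ; simp [history_frestrictLe]
    rw [this]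
    exact (measurable_of_countable _).comp (Preorder.measurable_frestrictLe _)

theorem integral_initLaw (M : MDP S A) (π : Policy S A) (F : S → A → ℝ) :
    ∫ z, F z.1 z.2 ∂(M.initLaw π).toMeasure = ∑ a, (π [] M.init a).toReal * F M.init a := by
  unfold initLaw
  rw [← PMF.toMeasure_map _ _ (measurable_of_countable _),
    integral_map (measurable_of_countable _).aemeasurable
      (measurable_of_countable _).aestronglyMeasurable, PMF.integral_eq_sum]
  simp

theorem integral_stepLaw (M : MDP S A) (π : Policy S A) {n : ℕ}
    (x : (i : Finset.Iic n) → S × A) (F : S → A → ℝ) :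
    ∫ z, F z.1 z.2 ∂(M.stepLaw π x).toMeasure =
      ∑ s, (M.P (x ⟨n, Finset.mem_Iic.2 le_rfl⟩).1 (x ⟨n, Finset.mem_Iic.2 le_rfl⟩).2 s).toReal *
        ∑ a, (π (history x) s a).toReal * F s a := by
  classical
  have hst : ∀ s a, M.stepLaw π x (s, a) =
      M.P (x ⟨n, Finset.mem_Iic.2 le_rfl⟩).1 (x ⟨n, Finset.mem_Iic.2 le_rfl⟩).2 s *
        π (history x) s a := by
    intro s a
    unfold stepLaw
    rw [PMF.bind_apply, tsum_eq_single s]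
    · congr 1
      rw [PMF.map_apply, tsum_eq_single a]
      · simp
      · intro b hb; rw [if_neg]; simpa using hb.symm
    · intro t ht
      rw [PMF.map_apply]
      simp [ht.symm]
  rw [PMF.integral_eq_sum, Fintype.sum_prod_type]
  refine Finset.sum_congr rfl fun s _ => ?_
  rw [Finset.mul_sum]
  refine Finset.sum_congr rfl fun a _ => ?_
  rw [hst, ENNReal.toReal_mul, smul_eq_mul, mul_assoc]

/-- The law of the first state-action pair. -/
theorem integral_run_zero (M : MDP S A) (π : Policy S A) (F : S → A → ℝ) :
    ∫ ψ, F (ψ 0).1 (ψ 0).2 ∂(M.runMeasure π) = ∑ a, (π [] M.init a).toReal * F M.init a := by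
  have zero : (M.runMeasure π).map (fun ψ => ψ 0) = (M.initLaw π).toMeasure := by
    unfold runMeasure Kernel.trajMeasure
    rw [Measure.map_comp _ _ (by fun_prop)]
    have : (Kernel.traj (X := fun _ => S × A) (M.stepKernel π) 0).map (fun ψ => ψ 0) =
        Kernel.deterministic (fun x : (i : Finset.Iic 0) → S × A => x ⟨0, by simp⟩)
          (by fun_prop) := by
      have h := Kernel.traj_map_frestrictLe (X := fun _ => S × A) (κ := M.stepKernel π) 0 0
      have h2 : (fun ψ : ℕ → S × A => ψ 0) =
        (fun x : (i : Finset.Iic 0) → S × A => x ⟨0, by simp⟩) ∘ Preorder.frestrictLe 0 := rfl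
      rw [h2, Kernel.map_comp_right _
        (Preorder.measurable_frestrictLe (X := fun _ : ℕ => S × A) 0) (by fun_prop), h,
        Kernel.partialTraj_self, Kernel.id_map]
    rw [this, Measure.deterministic_comp_eq_map, Measure.map_map (by fun_prop) (by fun_prop)]
    exact Measure.map_id
  rw [← integral_initLaw, ← zero, integral_map (measurable_pi_apply 0).aemeasurable
    (measurable_of_countable _).aestronglyMeasurable]

/-- The Markov property: conditioning on the first `n + 1` state-action pairs. -/
theorem integral_run_succ (M : MDP S A) (π : Policy S A) (n : ℕ)
    (G : List (S × A) → S → A → ℝ) :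
    ∫ ψ, G (pref ψ (n + 1)) (ψ (n + 1)).1 (ψ (n + 1)).2 ∂(M.runMeasure π) =
      ∫ ψ, ∑ s, (M.P (ψ n).1 (ψ n).2 s).toReal *
        ∑ a, (π (pref ψ (n + 1)) s a).toReal * G (pref ψ (n + 1)) s a ∂(M.runMeasure π) := by
  have h := Kernel.map_frestrictLe_trajMeasure_compProd_eq_map_trajMeasure (X := fun _ => S × A)
      (μ₀ := (M.initLaw π).toMeasure) (κ := M.stepKernel π) (a := n)
  change (M.runMeasure π).map _ ⊗ₘ _ = (M.runMeasure π).map _ at h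
  have h2 := congrArg (fun μ : Measure ((Finset.Iic n → S × A) × (S × A)) =>
    ∫ y, G (history y.1) y.2.1 y.2.2 ∂μ) h
  beta_reduce at h2
  have := (M.runMeasure π).isProbabilityMeasure_map
    (Preorder.measurable_frestrictLe (X := fun _ : ℕ => S × A) n).aemeasurable
  rw [Measure.integral_compProd (Integrable.of_finite),
    integral_map (by fun_prop) (measurable_of_countable _).aestronglyMeasurable,
    integral_map (by fun_prop) (measurable_of_countable _).aestronglyMeasurable] at h2
  simp only [history_frestrictLe] at h2
  rw [← h2]
  congr 1
  funext ψ
  have h3 := integral_stepLaw M π (Preorder.frestrictLe (π := fun _ => S × A) n ψ)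
    (fun s a => G (pref ψ (n + 1)) s a)
  rw [history_frestrictLe] at h3
  exact h3

end MDP

namespace MDP

open DLTL (pref length_pref pref_succ)

variable {S A : Type*} [Fintype S] [MeasurableSpace S] [MeasurableSingletonClass S]
  [Fintype A] [MeasurableSpace A] [MeasurableSingletonClass A]

theorem integrable_pref (M : MDP S A) (π : Policy S A) (G : List (S × A) → S × A → ℝ) (n : ℕ) :
    Integrable (fun ψ : ℕ → S × A => G (pref ψ n) (ψ n)) (M.runMeasure π) := by
  have hm := Preorder.measurable_frestrictLe (X := fun _ : ℕ => S × A) n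
  have := (M.runMeasure π).isProbabilityMeasure_map hm.aemeasurable
  have h : Integrable (fun x : (i : Finset.Iic n) → S × A =>
      G (history x).dropLast (x ⟨n, Finset.mem_Iic.2 le_rfl⟩))
      ((M.runMeasure π).map (Preorder.frestrictLe (π := fun _ => S × A) n)) := Integrable.of_finite
  have h2 := h.comp_measurable hm
  refine h2.congr (Filter.Eventually.of_forall fun ψ => ?_)
  simp only [Function.comp, history_frestrictLe, pref_succ, List.dropLast_concat]
  rfl

/-- The state of a reward machine after a finite run. -/
def runState {Q S A : Type*} (δ : Q → S → Q) (q₀ : Q) (h : List (S × A)) : Q :=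
  (h.map Prod.fst).foldl δ q₀

theorem runState_concat {Q S A : Type*} (δ : Q → S → Q) (q₀ : Q) (h : List (S × A)) (z : S × A) :
    runState δ q₀ (h ++ [z]) = δ (runState δ q₀ h) z.1 := by
  simp [runState]

/-- The value of playing the action `a` once in the state `(q, s)` of the product of the MDP with a
reward machine, if the continuation is worth `V`. -/
noncomputable def actionValue {Q : Type*} (M : MDP S A) (lam : ℝ) (δ : Q → S → Q) (r V : Q → S → ℝ)
    (q : Q) (s : S) (a : A) : ℝ :=
  r q s + lam * ∑ s', (M.P s a s').toReal * V (δ q s) s'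

/-- The discounted reward collected before time `T`, plus the expected continuation value after the
action at time `T`. -/
noncomputable def potential {Q : Type*} (M : MDP S A) (lam : ℝ) (δ : Q → S → Q) (q₀ : Q)
    (r V : Q → S → ℝ) (T : ℕ) (ψ : ℕ → S × A) : ℝ :=
  ∑ t ∈ Finset.range T, lam ^ t * r (runState δ q₀ (pref ψ t)) (ψ t).1 +
    lam ^ T * M.actionValue lam δ r V (runState δ q₀ (pref ψ T)) (ψ T).1 (ψ T).2

variable {Q : Type*}

theorem integrable_potential (M : MDP S A) (π : Policy S A) (lam : ℝ) (δ : Q → S → Q) (q₀ : Q)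
    (r V : Q → S → ℝ) (T : ℕ) :
    Integrable (M.potential lam δ q₀ r V T) (M.runMeasure π) := by
  unfold potential
  exact (integrable_finsetSum _ fun t _ => (M.integrable_pref π
    (fun h z => r (runState δ q₀ h) z.1) t).const_mul _).add ((M.integrable_pref π
    (fun h z => M.actionValue lam δ r V (runState δ q₀ h) z.1 z.2) T).const_mul _)

/-- If, on average over the policy, the action values do not exceed `V`, then the potential is a
supermartingale. -/
theorem integral_potential_le (M : MDP S A) (π : Policy S A) {lam : ℝ} (hlam : 0 ≤ lam)
    (δ : Q → S → Q) (q₀ : Q) (r V : Q → S → ℝ)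
    (h : ∀ l s, ∑ a, (π l s a).toReal * M.actionValue lam δ r V (runState δ q₀ l) s a ≤
      V (runState δ q₀ l) s) (T : ℕ) :
    ∫ ψ, M.potential lam δ q₀ r V T ψ ∂(M.runMeasure π) ≤ V q₀ M.init := by
  induction T with
  | zero =>
    have h0 : ∀ ψ, M.potential lam δ q₀ r V 0 ψ =
        M.actionValue lam δ r V q₀ (ψ 0).1 (ψ 0).2 := fun ψ => by
      simp [potential, pref, runState]
    simp only [h0]
    rw [integral_run_zero M π fun s a => M.actionValue lam δ r V q₀ s a]
    exact h [] M.init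
  | succ T ih =>
    refine le_trans ?_ ih
    set X := fun ψ : ℕ → S × A =>
      M.actionValue lam δ r V (runState δ q₀ (pref ψ (T + 1))) (ψ (T + 1)).1 (ψ (T + 1)).2
    set W := fun ψ : ℕ → S × A =>
      ∑ s, (M.P (ψ T).1 (ψ T).2 s).toReal * V (runState δ q₀ (pref ψ (T + 1))) s
    have hW : Integrable W (M.runMeasure π) := by
      have := M.integrable_pref π (fun l z => ∑ s, (M.P z.1 z.2 s).toReal *
        V (runState δ q₀ (l ++ [z])) s) T
      simpa only [← pref_succ] using this
    have hX : Integrable X (M.runMeasure π) := M.integrable_pref π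
      (fun l z => M.actionValue lam δ r V (runState δ q₀ l) z.1 z.2) (T + 1)
    have hstep : ∀ ψ, M.potential lam δ q₀ r V (T + 1) ψ =
        M.potential lam δ q₀ r V T ψ + lam ^ (T + 1) * (X ψ - W ψ) := fun ψ => by
      simp only [potential, X, W, Finset.sum_range_succ]
      rw [pref_succ ψ T, runState_concat]
      conv_rhs => rw [actionValue]
      ring
    have hXW : ∫ ψ, X ψ ∂(M.runMeasure π) ≤ ∫ ψ, W ψ ∂(M.runMeasure π) := by
      rw [integral_run_succ M π T fun l s a => M.actionValue lam δ r V (runState δ q₀ l) s a]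
      refine integral_mono ?_ hW fun ψ => Finset.sum_le_sum fun s _ =>
        mul_le_mul_of_nonneg_left (h _ s) ENNReal.toReal_nonneg
      have := M.integrable_pref π (fun l z => ∑ s, (M.P z.1 z.2 s).toReal *
        ∑ a, (π (l ++ [z]) s a).toReal *
          M.actionValue lam δ r V (runState δ q₀ (l ++ [z])) s a) T
      simpa only [← pref_succ] using this
    simp only [hstep]
    have hd : Integrable (fun ψ => lam ^ (T + 1) * (X ψ - W ψ)) (M.runMeasure π) :=
      (hX.sub hW).const_mul _
    rw [integral_add (integrable_potential M π lam δ q₀ r V T) hd,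
      integral_const_mul, integral_sub hX hW]
    nlinarith [mul_nonneg (pow_nonneg hlam (T + 1)) (sub_nonneg.2 hXW)]

/-- Under every policy, the expected potential converges to the value of the policy. -/
theorem tendsto_integral_potential {AP : Type*} [Finite Q] (M : MDP S A) (L : S → Set AP)
    {lam : Discount} {φ : DLTL AP} (hφ : φ.IsUniform lam) {δ : Q → S → Q} {q₀ : Q} {r : Q → S → ℝ}
    (hr : DLTL.IsRewardMachine L lam φ δ q₀ r) (V : Q → S → ℝ) (π : Policy S A) :
    Filter.Tendsto (fun T => ∫ ψ, M.potential lam δ q₀ r V T ψ ∂(M.runMeasure π)) Filter.atTop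
      (nhds (M.policyValue L φ π)) := by
  have := Fintype.ofFinite Q
  have hlim : Filter.Tendsto (fun T : ℕ => (lam : ℝ) ^ T) Filter.atTop (nhds 0) :=
    tendsto_pow_atTop_nhds_zero_of_lt_one lam.2.1 lam.2.2
  have hpref : ∀ (ψ : ℕ → S × A) t, runState δ q₀ (pref ψ t) =
      (pref (fun n => (ψ n).1) t).foldl δ q₀ := fun ψ t => by simp [runState, pref, Function.comp_def]
  set Y := fun (T : ℕ) (ψ : ℕ → S × A) =>
    ∑ t ∈ Finset.range T, (lam : ℝ) ^ t * r (runState δ q₀ (pref ψ t)) (ψ t).1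
  have hY : ∀ T ψ, |φ.value (fun n => L (ψ n).1) - Y T ψ| ≤ (lam : ℝ) ^ T := fun T ψ => by
    have := DLTL.abs_value_sub_sum_rewards_le hφ hr (fun n => (ψ n).1) T
    simpa only [Y, hpref] using this
  have hYint : ∀ T, Integrable (Y T) (M.runMeasure π) := fun T =>
    integrable_finsetSum _ fun t _ => (M.integrable_pref π
      (fun h z => r (runState δ q₀ h) z.1) t).const_mul _
  have hYm : ∀ T, Measurable (Y T) := fun T => by
    refine Finset.measurable_sum _ fun t _ => Measurable.const_mul ?_ _
    have : (fun ψ : ℕ → S × A => r (runState δ q₀ (pref ψ t)) (ψ t).1) =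
        fun ψ => (fun (q : Q) (z : S × A) => r q z.1) (runState δ q₀ (pref ψ t)) (ψ t) := rfl
    let _ : MeasurableSpace Q := ⊤
    exact (measurable_of_countable fun y : Q × (S × A) => r y.1 y.2.1).comp
      ((measurable_pref (runState δ q₀) t).prodMk (measurable_pi_apply t))
  have hvm : Measurable fun ψ : ℕ → S × A => φ.value (fun n => L (ψ n).1) := by
    refine measurable_of_tendsto_metrizable hYm (tendsto_pi_nhds.2 fun ψ => ?_)
    refine tendsto_iff_dist_tendsto_zero.2 (squeeze_zero (fun _ => dist_nonneg) (fun T => ?_) hlim)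
    rw [dist_comm, Real.dist_eq]
    exact hY T ψ
  have hvint : Integrable (fun ψ : ℕ → S × A => φ.value (fun n => L (ψ n).1)) (M.runMeasure π) :=
    Integrable.of_bound hvm.aestronglyMeasurable 1 (Filter.Eventually.of_forall fun ψ => by
      have h := DLTL.isUnitValued_value (fun n => L (ψ n).1) φ
      exact abs_le.2 ⟨by linarith [h.1], h.2⟩)
  set C := ∑ q, ∑ s, ∑ a, |M.actionValue lam δ r V q s a|
  have hC : ∀ q s a, |M.actionValue lam δ r V q s a| ≤ C := fun q s a => by
    refine le_trans ?_ (Finset.single_le_sum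
      (f := fun q => ∑ s, ∑ a, |M.actionValue lam δ r V q s a|) (fun q _ => by positivity)
      (Finset.mem_univ q))
    refine le_trans ?_ (Finset.single_le_sum
      (f := fun s => ∑ a, |M.actionValue lam δ r V q s a|) (fun q _ => by positivity)
      (Finset.mem_univ s))
    exact Finset.single_le_sum (f := fun a => |M.actionValue lam δ r V q s a|)
      (fun q _ => by positivity) (Finset.mem_univ a)
  have hlim' : Filter.Tendsto (fun T : ℕ => (1 + C) * (lam : ℝ) ^ T) Filter.atTop (nhds 0) := by
    simpa using hlim.const_mul (1 + C)
  refine tendsto_iff_dist_tendsto_zero.2 (squeeze_zero (fun _ => dist_nonneg) (fun T => ?_) hlim')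
  rw [policyValue, Real.dist_eq, ← integral_sub (integrable_potential M π _ _ _ _ _ T) hvint]
  have hb := norm_integral_le_of_norm_le_const (μ := M.runMeasure π) (C := (1 + C) * (lam : ℝ) ^ T)
    (f := fun ψ => M.potential lam δ q₀ r V T ψ - φ.value (fun n => L (ψ n).1))
    (Filter.Eventually.of_forall fun ψ => by
      have h1 := hY T ψ
      rw [abs_sub_comm] at h1
      have h2 : |(lam : ℝ) ^ T * M.actionValue lam δ r V (runState δ q₀ (pref ψ T)) (ψ T).1 (ψ T).2| ≤
          C * (lam : ℝ) ^ T := by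
        rw [abs_mul, abs_of_nonneg (pow_nonneg lam.2.1 T), mul_comm]
        exact mul_le_mul_of_nonneg_right (hC _ _ _) (pow_nonneg lam.2.1 T)
      have h3 : M.potential lam δ q₀ r V T ψ - φ.value (fun n => L (ψ n).1) =
          (Y T ψ - φ.value (fun n => L (ψ n).1)) +
          (lam : ℝ) ^ T * M.actionValue lam δ r V (runState δ q₀ (pref ψ T)) (ψ T).1 (ψ T).2 := by
        simp only [potential, Y]; ring
      rw [h3, Real.norm_eq_abs]
      exact (abs_add_le _ _).trans (by linarith))
  simpa using hb

theorem sum_toReal_pmf {α : Type*} [Fintype α] (p : PMF α) : ∑ a, (p a).toReal = 1 := by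
  rw [← ENNReal.toReal_sum fun a _ => p.apply_ne_top a, ← tsum_fintype (L := .unconditional _),
    p.tsum_coe, ENNReal.toReal_one]

/-- A solution of the Bellman equation for the product of the MDP with a reward machine certifies
the optimality of the policy that plays greedily, with the machine as its memory. -/
theorem isOptimal_of_bellman {AP : Type*} [Finite Q] (M : MDP S A) (L : S → Set AP)
    {lam : Discount} {φ : DLTL AP} (hφ : φ.IsUniform lam) {δ : Q → S → Q} {q₀ : Q} {r : Q → S → ℝ}
    (hr : DLTL.IsRewardMachine L lam φ δ q₀ r) (V : Q → S → ℝ) (act : Q → S → A)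
    (hle : ∀ q s a, M.actionValue lam δ r V q s a ≤ V q s)
    (heq : ∀ q s, M.actionValue lam δ r V q s (act q s) = V q s) :
    M.IsOptimal L φ (MemoryPolicy.toPolicy
      ⟨q₀, fun q s _ => δ q s, fun q s => PMF.pure (act q s)⟩) := by
  classical
  set π₀ : Policy S A := MemoryPolicy.toPolicy
      ⟨q₀, fun q s _ => δ q s, fun q s => PMF.pure (act q s)⟩
  have hup : ∀ π : Policy S A, M.policyValue L φ π ≤ V q₀ M.init := fun π =>
    le_of_tendsto' (tendsto_integral_potential M L hφ hr V π) fun T =>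
      integral_potential_le M π lam.2.1 δ q₀ r V (fun l s => by
        calc _ ≤ ∑ a, (π l s a).toReal * V (runState δ q₀ l) s := Finset.sum_le_sum fun a _ =>
              mul_le_mul_of_nonneg_left (hle _ s a) ENNReal.toReal_nonneg
          _ = _ := by rw [← Finset.sum_mul, sum_toReal_pmf, one_mul]) T
  have hlow : V q₀ M.init ≤ M.policyValue L φ π₀ := by
    refine ge_of_tendsto' (tendsto_integral_potential M L hφ hr V π₀) fun T => ?_
    -- the lower bound is the upper bound for the negated rewards
    have hneg : ∀ q s a, M.actionValue lam δ (fun q s => -r q s) (fun q s => -V q s) q s a =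
        -M.actionValue lam δ r V q s a := fun q s a => by
      simp only [actionValue, mul_neg, Finset.sum_neg_distrib]; ring
    have h := integral_potential_le M π₀ lam.2.1 δ q₀ (fun q s => -r q s) (fun q s => -V q s)
      (fun l s => by
        have hst : π₀ l s = PMF.pure (act (runState δ q₀ l) s) := by
          simp only [π₀, MemoryPolicy.toPolicy, runState, List.foldl_map]
        rw [hst, Finset.sum_eq_single (act (runState δ q₀ l) s)]
        · rw [hneg, heq]; simp
        · intro a _ ha; simp [PMF.pure_apply, ha]
        · simp) T
    have hpot : ∀ ψ, M.potential lam δ q₀ (fun q s => -r q s) (fun q s => -V q s) T ψ =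
        -M.potential lam δ q₀ r V T ψ := fun ψ => by
      simp only [potential, hneg, mul_neg, Finset.sum_neg_distrib]; ring
    simp only [hpot, integral_neg] at h
    linarith
  refine le_antisymm (le_ciSup (f := fun π => M.policyValue L φ π) ⟨V q₀ M.init, ?_⟩ π₀) ?_
  · rintro _ ⟨π, rfl⟩; exact hup π
  · have : Nonempty (Policy S A) := ⟨π₀⟩
    exact ciSup_le fun π => (hup π).trans hlow

end MDP

/-! ### Solutions of the Bellman equation -/

namespace MDP

variable {S A Q : Type*} [Fintype S]

theorem sum_toReal_mul_le (p : PMF S) {f : S → ℝ} {c : ℝ} (h : ∀ s, f s ≤ c) :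
    ∑ s, (p s).toReal * f s ≤ c := by
  calc _ ≤ ∑ s, (p s).toReal * c := Finset.sum_le_sum fun s _ =>
        mul_le_mul_of_nonneg_left (h s) ENNReal.toReal_nonneg
    _ = c := by rw [← Finset.sum_mul, sum_toReal_pmf, one_mul]

variable [Finite Q]

theorem exists_bellman [Fintype A] [Nonempty A] (M : MDP S A) (lam : Discount) (δ : Q → S → Q)
    (r : Q → S → ℝ) :
    ∃ (V : Q → S → ℝ) (act : Q → S → A),
      (∀ q s a, M.actionValue lam δ r V q s a ≤ V q s) ∧
      (∀ q s, M.actionValue lam δ r V q s (act q s) = V q s) := by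
  have := Fintype.ofFinite Q
  set T : (Q → S → ℝ) → (Q → S → ℝ) := fun V q s =>
    Finset.univ.sup' Finset.univ_nonempty (M.actionValue lam δ r V q s) with hT
  have hAV : ∀ (V W : Q → S → ℝ) q s a, M.actionValue lam δ r V q s a ≤
      M.actionValue lam δ r W q s a + lam * dist V W := fun V W q s a => by
    have h1 : ∑ s', (M.P s a s').toReal * (V (δ q s) s' - W (δ q s) s') ≤ dist V W :=
      sum_toReal_mul_le _ fun s' => (le_abs_self _).trans
        ((dist_le_pi_dist (V (δ q s)) (W (δ q s)) s').trans (dist_le_pi_dist V W (δ q s)))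
    have h2 := mul_le_mul_of_nonneg_left h1 lam.2.1
    simp only [mul_sub, Finset.sum_sub_distrib] at h2
    simp only [actionValue]
    linarith
  have hle : ∀ V W q s, T V q s ≤ T W q s + lam * dist V W := fun V W q s =>
    Finset.sup'_le _ _ fun a _ => (hAV V W q s a).trans
      (by gcongr; exact Finset.le_sup' (M.actionValue lam δ r W q s) (Finset.mem_univ a))
  have hc : ContractingWith ⟨lam, lam.2.1⟩ T := by
    refine ⟨by exact_mod_cast lam.2.2, LipschitzWith.of_dist_le_mul fun V W => ?_⟩
    have h0 : 0 ≤ (lam : ℝ) * dist V W := mul_nonneg lam.2.1 dist_nonneg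
    change dist (T V) (T W) ≤ (lam : ℝ) * dist V W
    refine (dist_pi_le_iff h0).2 fun q => (dist_pi_le_iff h0).2 fun s => ?_
    rw [Real.dist_eq, abs_sub_le_iff]
    have h1 := hle V W q s
    have h2 := hle W V q s
    rw [dist_comm] at h2
    exact ⟨by linarith, by linarith⟩
  have hfix : T (hc.fixedPoint T) = hc.fixedPoint T := hc.fixedPoint_isFixedPt
  set V := hc.fixedPoint T
  have hV : ∀ q s, Finset.univ.sup' Finset.univ_nonempty (M.actionValue lam δ r V q s) = V q s :=
    fun q s => congrFun (congrFun hfix q) s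
  have hex : ∀ q s, ∃ a, M.actionValue lam δ r V q s a = V q s := fun q s => by
    obtain ⟨a, -, ha⟩ := Finset.exists_mem_eq_sup' Finset.univ_nonempty
      (M.actionValue lam δ r V q s)
    exact ⟨a, by rw [← hV, ha]⟩
  choose act hact using hex
  exact ⟨V, act, fun q s a => by rw [← hV]; exact Finset.le_sup' _ (Finset.mem_univ a), hact⟩

/-- Minimum principle for the discounted averaging operator of a stationary policy. -/
theorem nonneg_of_discounted_le (M : MDP S A) (lam : Discount) (δ : Q → S → Q) (act : Q → S → A)
    {D : Q → S → ℝ} (hD : ∀ q s, lam * ∑ s', (M.P s (act q s) s').toReal * D (δ q s) s' ≤ D q s)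
    (q : Q) (s : S) : 0 ≤ D q s := by
  have := Nonempty.intro q
  have := Nonempty.intro s
  obtain ⟨⟨q₁, s₁⟩, hmin⟩ := Finite.exists_min fun x : Q × S => D x.1 x.2
  refine le_trans ?_ (hmin (q, s))
  have h1 : ∑ s', (M.P s₁ (act q₁ s₁) s').toReal * -D (δ q₁ s₁) s' ≤ -D q₁ s₁ :=
    sum_toReal_mul_le _ fun s' => neg_le_neg (hmin (δ q₁ s₁, s'))
  have h2 := mul_le_mul_of_nonneg_left h1 lam.2.1
  simp only [mul_neg, Finset.sum_neg_distrib] at h2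
  have h3 := hD q₁ s₁
  have h4 := lam.2.2
  simp only
  nlinarith

/-- With rational data, the value function of the Bellman equation is rational: it solves the linear
system of the greedy policy, whose matrix is invertible over the rational numbers. -/
theorem exists_rational_bellman {n m c : ℕ} (hm : 0 < m) (M : MDP (Fin n) (Fin m))
    {p : Fin n → Fin m → Fin n → ℚ≥0} (hp : ∀ s a s', (M.P s a s').toReal = (p s a s' : ℝ))
    {lam : Discount} {ρ : ℚ≥0} (hρ : (lam : ℝ) = (ρ : ℝ)) (δ : Fin c → Fin n → Fin c)
    (r : Fin c → Fin n → ℚ≥0) :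
    ∃ (V : Fin c → Fin n → ℚ≥0) (act : Fin c → Fin n → Fin m),
      (∀ q s a, r q s + ρ * ∑ s', p s a s' * V (δ q s) s' ≤ V q s) ∧
      (∀ q s, r q s + ρ * ∑ s', p s (act q s) s' * V (δ q s) s' = V q s) := by
  have : Nonempty (Fin m) := ⟨⟨0, hm⟩⟩
  obtain ⟨V, act, hle, heq⟩ := M.exists_bellman lam δ (fun q s => (r q s : ℝ))
  have huniq : ∀ D : Fin c → Fin n → ℝ,
      (∀ q s, lam * ∑ s', (M.P s (act q s) s').toReal * D (δ q s) s' = D q s) → D = 0 := by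
    intro D hD
    funext q s
    refine le_antisymm ?_ (M.nonneg_of_discounted_le lam δ act (fun q s => (hD q s).le) q s)
    have := M.nonneg_of_discounted_le lam δ act (D := fun q s => -D q s) (fun q s => by
      rw [← hD]; simp only [mul_neg, Finset.sum_neg_distrib]; rfl) q s
    simpa using this
  let f : (Fin c → Fin n → ℚ) →ₗ[ℚ] (Fin c → Fin n → ℚ) :=
    { toFun := fun x q s => x q s - (ρ : ℚ) * ∑ s', (p s (act q s) s' : ℚ) * x (δ q s) s'
      map_add' := fun x y => by
        funext q s
        simp only [Pi.add_apply, mul_add, Finset.sum_add_distrib]; ring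
      map_smul' := fun t x => by
        funext q s
        have h : ∑ s', (p s (act q s) s' : ℚ) * (t • x) (δ q s) s' =
            t * ∑ s', (p s (act q s) s' : ℚ) * x (δ q s) s' := by
          rw [Finset.mul_sum]
          exact Finset.sum_congr rfl fun s' _ => by simp only [Pi.smul_apply, smul_eq_mul]; ring
        rw [h]
        simp only [Pi.smul_apply, smul_eq_mul, RingHom.id_apply]
        ring }
  have hcast : ∀ (x : Fin c → Fin n → ℚ) q s, ((f x q s : ℚ) : ℝ) = (x q s : ℝ) -
      lam * ∑ s', (M.P s (act q s) s').toReal * (x (δ q s) s' : ℝ) := fun x q s => by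
    have : f x q s = x q s - (ρ : ℚ) * ∑ s', (p s (act q s) s' : ℚ) * x (δ q s) s' := rfl
    rw [this, hρ]
    push_cast
    simp only [hp]
  have hinj : Function.Injective f := by
    refine (injective_iff_map_eq_zero f).2 fun x hx => ?_
    have h0 := huniq (fun q s => (x q s : ℝ)) fun q s => by
      have := hcast x q s
      rw [hx] at this
      simp only [Pi.zero_apply, Rat.cast_zero] at this
      linarith
    funext q s
    have : (x q s : ℝ) = 0 := congrFun (congrFun h0 q) s
    exact_mod_cast this
  obtain ⟨x, hx⟩ := LinearMap.injective_iff_surjective.1 hinj (fun q s => (r q s : ℚ))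
  have hVx : ∀ q s, V q s = (x q s : ℝ) := by
    have h0 := huniq (fun q s => V q s - (x q s : ℝ)) fun q s => by
      have h1 := hcast x q s
      rw [hx] at h1
      have h2 := heq q s
      simp only [actionValue] at h2
      simp only [mul_sub, Finset.sum_sub_distrib]
      push_cast at h1
      linarith
    intro q s
    exact sub_eq_zero.1 (congrFun (congrFun h0 q) s)
  have hx0 : ∀ q s, 0 ≤ x q s := fun q s => by
    have := M.nonneg_of_discounted_le lam δ act (D := V) (fun q s => by
      rw [← heq q s, actionValue]
      have : (0 : ℝ) ≤ r q s := NNRat.cast_nonneg _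
      linarith) q s
    rw [hVx] at this
    exact_mod_cast this
  obtain ⟨y, hy⟩ : ∃ y : Fin c → Fin n → ℚ≥0, ∀ q s, ((y q s : ℚ≥0) : ℚ) = x q s :=
    ⟨fun q s => (x q s).toNNRat, fun q s => Rat.coe_toNNRat _ (hx0 q s)⟩
  have hVy : ∀ q s, V q s = (y q s : ℝ) := fun q s => by rw [hVx, ← hy]; norm_cast
  refine ⟨y, act, fun q s a => ?_, fun q s => ?_⟩
  · have h1 := hle q s a
    simp only [actionValue, hVy, hp, hρ] at h1
    exact_mod_cast h1
  · have h1 := heq q s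
    simp only [actionValue, hVy, hp, hρ] at h1
    exact_mod_cast h1

end MDP

/-! ### Primitive recursive building blocks -/

-- `fun_prop` proves primitive recursiveness by following the syntax of a function

attribute [fun_prop] Primrec
attribute [fun_prop] Primrec.id Primrec.const Primrec.comp Primrec.fst Primrec.snd Primrec.pair

namespace PrimrecFun

variable {α β γ : Type*} [Primcodable α] [Primcodable β] [Primcodable γ]

@[fun_prop] theorem add {f g : α → ℕ} (hf : Primrec f) (hg : Primrec g) :
    Primrec fun a => f a + g a := Primrec.nat_add.comp hf hg

@[fun_prop] theorem mul {f g : α → ℕ} (hf : Primrec f) (hg : Primrec g) :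
    Primrec fun a => f a * g a := Primrec.nat_mul.comp hf hg

@[fun_prop] theorem sub {f g : α → ℕ} (hf : Primrec f) (hg : Primrec g) :
    Primrec fun a => f a - g a := Primrec.nat_sub.comp hf hg

@[fun_prop] theorem pow {f g : α → ℕ} (hf : Primrec f) (hg : Primrec g) :
    Primrec fun a => f a ^ g a :=
  (Primrec₂.unpaired'.1 Nat.Primrec.pow).comp hf hg

@[fun_prop] theorem max {f g : α → ℕ} (hf : Primrec f) (hg : Primrec g) :
    Primrec fun a => Max.max (f a) (g a) := Primrec.nat_max.comp hf hg

@[fun_prop] theorem min {f g : α → ℕ} (hf : Primrec f) (hg : Primrec g) :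
    Primrec fun a => Min.min (f a) (g a) := Primrec.nat_min.comp hf hg

@[fun_prop] theorem natPair {f g : α → ℕ} (hf : Primrec f) (hg : Primrec g) :
    Primrec fun a => Nat.pair (f a) (g a) := Primrec₂.natPair.comp hf hg

@[fun_prop] theorem decide_eq {f g : α → ℕ} (hf : Primrec f) (hg : Primrec g) :
    Primrec fun a => decide (f a = g a) :=
  primrecPred_iff_primrec_decide.1 (Primrec.eq.comp hf hg)

@[fun_prop] theorem decide_lt {f g : α → ℕ} (hf : Primrec f) (hg : Primrec g) :
    Primrec fun a => decide (f a < g a) :=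
  primrecPred_iff_primrec_decide.1 (Primrec.nat_lt.comp hf hg)

@[fun_prop] theorem decide_le {f g : α → ℕ} (hf : Primrec f) (hg : Primrec g) :
    Primrec fun a => decide (f a ≤ g a) :=
  primrecPred_iff_primrec_decide.1 (Primrec.nat_le.comp hf hg)

@[fun_prop] theorem and {f g : α → Bool} (hf : Primrec f) (hg : Primrec g) :
    Primrec fun a => f a && g a := Primrec.and.comp hf hg

@[fun_prop] theorem or {f g : α → Bool} (hf : Primrec f) (hg : Primrec g) :
    Primrec fun a => f a || g a := Primrec.or.comp hf hg

@[fun_prop] theorem not {f : α → Bool} (hf : Primrec f) :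
    Primrec fun a => !(f a) := Primrec.not.comp hf

@[fun_prop] theorem cond {c : α → Bool} {f g : α → β} (hc : Primrec c) (hf : Primrec f)
    (hg : Primrec g) : Primrec fun a => bif c a then f a else g a := Primrec.cond hc hf hg

@[fun_prop] theorem listGetD (d : β) {f : α → List β} {g : α → ℕ} (hf : Primrec f)
    (hg : Primrec g) : Primrec fun a => (f a).getD (g a) d := (Primrec.list_getD d).comp hf hg

@[fun_prop] theorem listRange {f : α → ℕ} (hf : Primrec f) :
    Primrec fun a => List.range (f a) := Primrec.list_range.comp hf

@[fun_prop] theorem listLength {f : α → List β} (hf : Primrec f) :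
    Primrec fun a => (f a).length := Primrec.list_length.comp hf

@[fun_prop] theorem listTail {f : α → List β} (hf : Primrec f) :
    Primrec fun a => (f a).tail := Primrec.list_tail.comp hf

@[fun_prop] theorem listCons {f : α → β} {g : α → List β} (hf : Primrec f) (hg : Primrec g) :
    Primrec fun a => f a :: g a := Primrec.list_cons.comp hf hg

@[fun_prop] theorem listAppend {f g : α → List β} (hf : Primrec f) (hg : Primrec g) :
    Primrec fun a => f a ++ g a := Primrec.list_append.comp hf hg

@[fun_prop] theorem listMap {f : α → List β} {g : α → β → γ} (hf : Primrec f)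
    (hg : Primrec fun p : α × β => g p.1 p.2) : Primrec fun a => (f a).map (g a) :=
  Primrec.list_map hf hg

@[fun_prop] theorem listFlatMap {f : α → List β} {g : α → β → List γ} (hf : Primrec f)
    (hg : Primrec fun p : α × β => g p.1 p.2) : Primrec fun a => (f a).flatMap (g a) :=
  Primrec.list_flatMap hf hg

@[fun_prop] theorem listFoldr {f : α → List β} {g : α → β → γ → γ} {i : α → γ} (hf : Primrec f)
    (hg : Primrec fun p : α × (β × γ) => g p.1 p.2.1 p.2.2) (hi : Primrec i) :
    Primrec fun a => (f a).foldr (g a) (i a) := Primrec.list_foldr (h := fun a p => g a p.1 p.2) hf hi hg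

@[fun_prop] theorem listFoldl {f : α → List β} {g : α → γ → β → γ} {i : α → γ} (hf : Primrec f)
    (hg : Primrec fun p : α × (γ × β) => g p.1 p.2.1 p.2.2) (hi : Primrec i) :
    Primrec fun a => (f a).foldl (g a) (i a) := Primrec.list_foldl (h := fun a p => g a p.1 p.2) hf hi hg

@[fun_prop] theorem listSum {f : α → List ℕ} (hf : Primrec f) :
    Primrec fun a => (f a).sum :=
  Primrec.of_eq (f := fun a => (f a).foldr (fun x y => x + y) 0) (by fun_prop) fun _ => rfl

@[fun_prop] theorem listAll {f : α → List β} {g : α → β → Bool} (hf : Primrec f)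
    (hg : Primrec fun p : α × β => g p.1 p.2) : Primrec fun a => (f a).all (g a) := by
  refine Primrec.of_eq (f := fun a => (f a).foldr (fun x y => g a x && y) true) ?_ fun a => ?_
  · refine listFoldr hf ?_ (by fun_prop)
    exact Primrec.and.comp (hg.comp (Primrec.fst.pair (Primrec.fst.comp Primrec.snd)))
      (Primrec.snd.comp Primrec.snd)
  · induction f a with
    | nil => rfl
    | cons x l ih => simp [ih]

@[fun_prop] theorem natRec {f : α → ℕ} {i : α → β} {g : α → ℕ → β → β} (hf : Primrec f)
    (hi : Primrec i) (hg : Primrec fun p : α × (ℕ × β) => g p.1 p.2.1 p.2.2) :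
    Primrec fun a => Nat.rec (motive := fun _ => β) (i a) (g a) (f a) :=
  Primrec.nat_rec' (h := fun a p => g a p.1 p.2) hf hi hg

end PrimrecFun

/-! ### Evaluation of formulas in Polish notation -/

/-- Lookup of a label in a table of labels. -/
def lookLabel (T : List (List Bool)) (s b : ℕ) : Bool := (T.getD s []).getD b false

/-- One step of the evaluation of a formula in Polish notation, from right to left, on the finite
word `w`. The entries of the stack belong to subformulas; each is the list, over the positions `i` of
the word, of the numerators of the finite-horizon values of the subformula on the suffix from `i` on,
the denominator being `b ^ (|w| - i)`. The discount factor is `a / b`. -/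
def evalToken (T : List (List Bool)) (a b : ℕ) (w : List ℕ) (tok : ℕ × ℕ) (st : List (List ℕ)) :
    List (List ℕ) :=
  bif decide (tok.1 = 0) then
    ((List.range w.length).map fun i =>
      bif lookLabel T (w.getD i 0) tok.2 then b ^ (w.length - i) else 0) :: st
  else bif decide (tok.1 = 1) then
    ((List.range w.length).map fun i => b ^ (w.length - i) - (st.getD 0 []).getD i 0) :: st.tail
  else bif decide (tok.1 = 2) then
    ((List.range w.length).map fun i =>
      max ((st.getD 0 []).getD i 0) ((st.getD 1 []).getD i 0)) :: st.tail.tail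
  else bif decide (tok.1 = 3) then
    ((List.range w.length).map fun i => a * (st.getD 0 []).getD (i + 1) 0) :: st.tail
  else
    ((List.range w.length).foldr (fun i acc =>
      max ((st.getD 1 []).getD i 0) (min ((st.getD 0 []).getD i 0) (a * acc.getD 0 0)) :: acc) []) ::
      st.tail.tail

/-- The numerator, with denominator `b ^ |w|`, of the finite-horizon value on the word `w`. -/
def horizonNum (T : List (List Bool)) (a b : ℕ) (toks : List (ℕ × ℕ)) (w : List ℕ) : ℕ :=
  ((toks.foldr (evalToken T a b w) []).getD 0 []).getD 0 0

@[fun_prop] theorem primrec_lookLabel {α : Type*} [Primcodable α] {f : α → List (List Bool)}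
    {g h : α → ℕ} (hf : Primrec f) (hg : Primrec g) (hh : Primrec h) :
    Primrec fun x => lookLabel (f x) (g x) (h x) := by
  unfold lookLabel; fun_prop

@[fun_prop] theorem primrec_evalToken {α : Type*} [Primcodable α] {T : α → List (List Bool)}
    {a b : α → ℕ} {w : α → List ℕ} {tok : α → ℕ × ℕ} {st : α → List (List ℕ)} (hT : Primrec T)
    (ha : Primrec a) (hb : Primrec b) (hw : Primrec w) (ht : Primrec tok) (hs : Primrec st) :
    Primrec fun x => evalToken (T x) (a x) (b x) (w x) (tok x) (st x) := by
  unfold evalToken; fun_prop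

@[fun_prop] theorem primrec_horizonNum {α : Type*} [Primcodable α] {T : α → List (List Bool)}
    {a b : α → ℕ} {w : α → List ℕ} {toks : α → List (ℕ × ℕ)} (hT : Primrec T)
    (ha : Primrec a) (hb : Primrec b) (hw : Primrec w) (ht : Primrec toks) :
    Primrec fun x => horizonNum (T x) (a x) (b x) (toks x) (w x) := by
  unfold horizonNum; fun_prop

theorem getD_map_range {β : Type*} (f : ℕ → β) (l i : ℕ) (d : β) :
    ((List.range l).map f).getD i d = if i < l then f i else d := by
  split_ifs with h
  · simp [List.getD, h]
  · simp [List.getD, not_lt.1 h]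

theorem getD_ofFn {β : Type*} {n : ℕ} (f : Fin n → β) (i : Fin n) (d : β) :
    (List.ofFn f).getD i d = f i := by
  simp [List.getD]

/-- The list of a sequence defined by recursion from the right. -/
theorem getD_foldr_range (f : ℕ → ℕ → ℕ) (l i : ℕ) :
    ((List.range l).foldr (fun i acc => f i (acc.getD 0 0) :: acc) []).getD i 0 =
      if i < l then
        f i (((List.range l).foldr (fun i acc => f i (acc.getD 0 0) :: acc) []).getD (i + 1) 0)
      else 0 := by
  have key : ∀ k j i, ((List.range' j k).foldr (fun i acc => f i (acc.getD 0 0) :: acc) []).getD i 0 =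
      if i < k then f (j + i)
        (((List.range' j k).foldr (fun i acc => f i (acc.getD 0 0) :: acc) []).getD (i + 1) 0)
      else 0 := by
    intro k
    induction k with
    | zero => intro j i; simp
    | succ k ih =>
      intro j i
      rw [List.range'_succ, List.foldr_cons]
      cases i with
      | zero => simp
      | succ i =>
        rw [List.getD_cons_succ, List.getD_cons_succ, ih (j + 1) i]
        simp only [Nat.add_lt_add_iff_right]
        rw [show j + 1 + i = j + (i + 1) by omega]
  rw [List.range_eq_range']
  have := key l 0 i
  rwa [Nat.zero_add] at this

namespace DLTL

open Classical in
/-- The table of labels that is part of the code of an instance. -/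
noncomputable def labelTable {n k : ℕ} (L : Fin n → Set (Fin k)) : List (List Bool) :=
  List.ofFn fun s => List.ofFn fun b => decide (b ∈ L s)

open Classical in
theorem lookLabel_labelTable {n k : ℕ} (L : Fin n → Set (Fin k)) (s : Fin n) (b : Fin k) :
    lookLabel (labelTable L) s b = decide (b ∈ L s) := by
  unfold lookLabel labelTable
  rw [getD_ofFn, getD_ofFn]

/-- Evaluating the tokens of a formula pushes one list onto the stack, the list of the scaled
finite-horizon values of the formula on the suffixes of the word. -/
theorem exists_evalToken {n k a b : ℕ} (hb : 0 < b) (L : Fin n → Set (Fin k)) {lam : Discount}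
    (hlam : (lam : ℝ) = (a : ℝ) / b) {φ : DLTL (Fin k)} (hφ : IsUniform lam φ)
    (w : List (Fin n)) :
    ∃ v : List ℕ,
      (∀ i, (v.getD i 0 : ℝ) = (b : ℝ) ^ (w.length - i) * horizon ((w.drop i).map L) 0 φ) ∧
      ∀ st, φ.tokens.foldr (evalToken (labelTable L) a b (w.map Fin.val)) st = v :: st := by
  classical
  have hb' : (b : ℝ) ≠ 0 := by exact_mod_cast hb.ne'
  have hout : ∀ (φ : DLTL (Fin k)) i, ¬ i < w.length →
      (b : ℝ) ^ (w.length - i) * horizon ((w.drop i).map L) 0 φ = 0 := fun φ i hi => by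
    rw [List.drop_eq_nil_of_le (not_lt.1 hi)]; simp [horizon_nil]
  have hdrop : ∀ i (hi : i < w.length), horizon ((w.drop i).map L) 0 =
      unfold (L w[i]) (horizon ((w.drop (i + 1)).map L) 0) := fun i hi => by
    rw [List.drop_eq_getElem_cons hi, List.map_cons, horizon_cons]
  have hget : ∀ i (hi : i < w.length), (w.map Fin.val).getD i 0 = (w[i] : ℕ) := fun i hi => by
    simp [List.getD, hi]
  have hscale : ∀ i, i < w.length → ∀ x : ℝ,
      (b : ℝ) ^ (w.length - i) * ((lam : ℝ) * x) = a * ((b : ℝ) ^ (w.length - (i + 1)) * x) := by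
    intro i hi x
    rw [show w.length - i = (w.length - (i + 1)) + 1 by omega, pow_succ, hlam]
    field_simp
  have hp : ∀ i, (0 : ℝ) ≤ (b : ℝ) ^ (w.length - i) := fun i => by positivity
  induction φ with
  | atom c =>
    refine ⟨(List.range w.length).map fun i =>
      bif lookLabel (labelTable L) ((w.map Fin.val).getD i 0) c then b ^ (w.length - i) else 0,
      fun i => ?_, fun st => by simp [tokens, evalToken]⟩
    rw [getD_map_range]
    split_ifs with hi
    · rw [hget i hi, lookLabel_labelTable, hdrop i hi]
      by_cases h : c ∈ L w[i] <;> simp [unfold, h]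
    · rw [hout _ _ hi, Nat.cast_zero]
  | neg φ ih =>
    obtain ⟨v, hv, hst⟩ := ih hφ
    refine ⟨(List.range w.length).map fun i => b ^ (w.length - i) - v.getD i 0,
      fun i => ?_, fun st => by simp [tokens, evalToken, hst]⟩
    rw [getD_map_range]
    split_ifs with hi
    · have h1 := (isUnitValued_horizon ((w.drop i).map L) isUnitValued_zero φ).2
      have h2 : v.getD i 0 ≤ b ^ (w.length - i) := by
        have : (v.getD i 0 : ℝ) ≤ ((b ^ (w.length - i) : ℕ) : ℝ) := by
          rw [hv]; push_cast; exact mul_le_of_le_one_right (hp i) h1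
        exact_mod_cast this
      rw [Nat.cast_sub h2, hv, hdrop i hi]
      simp only [unfold]
      push_cast; ring
    · rw [hout _ _ hi, Nat.cast_zero]
  | disj φ ψ ih₁ ih₂ =>
    obtain ⟨v₁, hv₁, hst₁⟩ := ih₁ hφ.1
    obtain ⟨v₂, hv₂, hst₂⟩ := ih₂ hφ.2
    refine ⟨(List.range w.length).map fun i => max (v₁.getD i 0) (v₂.getD i 0),
      fun i => ?_, fun st => by simp [tokens, evalToken, hst₁, hst₂, List.foldr_append]⟩
    rw [getD_map_range]
    split_ifs with hi
    · rw [Nat.cast_max, hv₁, hv₂, ← mul_max_of_nonneg _ _ (hp i), hdrop i hi]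
      simp only [unfold]
    · rw [hout _ _ hi, Nat.cast_zero]
  | next l φ ih =>
    obtain ⟨rfl, hφ⟩ := hφ
    obtain ⟨v, hv, hst⟩ := ih hφ
    refine ⟨(List.range w.length).map fun i => a * v.getD (i + 1) 0,
      fun i => ?_, fun st => by simp [tokens, evalToken, hst]⟩
    rw [getD_map_range]
    split_ifs with hi
    · rw [Nat.cast_mul, hv, hdrop i hi]
      simp only [unfold]
      rw [hscale i hi]
    · rw [hout _ _ hi, Nat.cast_zero]
  | untl l φ ψ ih₁ ih₂ =>
    have hU := hφ
    obtain ⟨rfl, hφ, hψ⟩ := hφ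
    obtain ⟨v₁, hv₁, hst₁⟩ := ih₁ hφ
    obtain ⟨v₂, hv₂, hst₂⟩ := ih₂ hψ
    set f : ℕ → ℕ → ℕ := fun i t => max (v₂.getD i 0) (min (v₁.getD i 0) (a * t)) with hf
    refine ⟨(List.range w.length).foldr (fun i acc => f i (acc.getD 0 0) :: acc) [],
      fun i => ?_, fun st => by
        simp [tokens, evalToken, hst₁, hst₂, List.foldr_append, hf]⟩
    induction hk : w.length - i generalizing i with
    | zero =>
      rw [getD_foldr_range, if_neg (by omega), Nat.cast_zero, ← hk]
      exact (hout _ _ (by omega)).symm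
    | succ k ih =>
      have hi : i < w.length := by omega
      rw [getD_foldr_range, if_pos hi, ← hk]
      simp only [hf]
      rw [Nat.cast_max, Nat.cast_min, Nat.cast_mul, ih (i + 1) (by omega), hv₁, hv₂,
        show k = w.length - (i + 1) by omega, ← hscale i hi, ← mul_min_of_nonneg _ _ (hp i),
        ← mul_max_of_nonneg _ _ (hp i), hdrop i hi]
      simp only [unfold]

theorem horizonNum_eq {n k a b : ℕ} (hb : 0 < b) (L : Fin n → Set (Fin k)) {lam : Discount}
    (hlam : (lam : ℝ) = (a : ℝ) / b) {φ : DLTL (Fin k)} (hφ : IsUniform lam φ)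
    (w : List (Fin n)) :
    (horizonNum (labelTable L) a b φ.tokens (w.map Fin.val) : ℝ) =
      (b : ℝ) ^ w.length * horizon (w.map L) 0 φ := by
  obtain ⟨v, hv, hst⟩ := exists_evalToken hb L hlam hφ w
  have := hv 0
  rw [horizonNum, hst]
  simpa using this

end DLTL

/-! ### Certificates -/

/-- The words of length `l` over the alphabet `0, …, n - 1`. -/
def words (n : ℕ) : ℕ → List (List ℕ)
  | 0 => [[]]
  | l + 1 => (words n l).flatMap fun w => (List.range n).map fun s => w ++ [s]

theorem map_val_mem_words {n : ℕ} (w : List (Fin n)) : w.map Fin.val ∈ words n w.length := by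
  induction w using List.reverseRecOn with
  | nil => simp [words]
  | append_singleton w s ih =>
    rw [List.length_append, List.length_singleton, words, List.mem_flatMap]
    exact ⟨_, ih, List.mem_map.2 ⟨s, by simp, by simp⟩⟩

theorem exists_of_mem_words {n l : ℕ} {w : List ℕ} (hw : w ∈ words n l) :
    ∃ v : List (Fin n), v.length = l ∧ v.map Fin.val = w := by
  induction l generalizing w with
  | zero => exact ⟨[], rfl, by simpa [words, eq_comm] using hw⟩
  | succ l ih =>
    rw [words, List.mem_flatMap] at hw
    obtain ⟨u, hu, hw⟩ := hw
    obtain ⟨s, hs, rfl⟩ := List.mem_map.1 hw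
    obtain ⟨v, hv, rfl⟩ := ih hu
    exact ⟨v ++ [⟨s, List.mem_range.1 hs⟩], by simp [hv], by simp⟩

/-- Lookup in a table with two indices that is stored as a list. -/
def look₂ (t : List ℕ) (i j : ℕ) : ℕ := t.getD (Nat.pair i j) 0

/-- Lookup in a table with three indices that is stored as a list. -/
def look₃ (t : List ℕ) (i j k : ℕ) : ℕ := t.getD (Nat.pair (Nat.pair i j) k) 0

theorem exists_table₂ {I J : ℕ} (g : Fin I → Fin J → ℕ) :
    ∃ t, ∀ (i : Fin I) (j : Fin J), look₂ t i j = g i j := by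
  refine ⟨(List.range (Nat.pair I J)).map fun z =>
    if h : z.unpair.1 < I ∧ z.unpair.2 < J then g ⟨_, h.1⟩ ⟨_, h.2⟩ else 0, fun i j => ?_⟩
  have h : Nat.pair i j < Nat.pair I J :=
    (Nat.pair_lt_pair_left _ i.2).trans (Nat.pair_lt_pair_right _ j.2)
  rw [look₂, getD_map_range, if_pos h]
  simp

theorem exists_table₃ {I J K : ℕ} (g : Fin I → Fin J → Fin K → ℕ) :
    ∃ t, ∀ (i : Fin I) (j : Fin J) (k : Fin K), look₃ t i j k = g i j k := by
  refine ⟨(List.range (Nat.pair (Nat.pair I J) K)).map fun z =>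
    if h : (z.unpair.1.unpair.1 < I ∧ z.unpair.1.unpair.2 < J) ∧ z.unpair.2 < K then
      g ⟨_, h.1.1⟩ ⟨_, h.1.2⟩ ⟨_, h.2⟩ else 0, fun i j k => ?_⟩
  have h : Nat.pair (Nat.pair i j) k < Nat.pair (Nat.pair I J) K :=
    (Nat.pair_lt_pair_left _ ((Nat.pair_lt_pair_left _ i.2).trans
      (Nat.pair_lt_pair_right _ j.2))).trans (Nat.pair_lt_pair_right _ k.2)
  rw [look₃, getD_map_range, if_pos h]
  simp

/-- A certificate for the optimality of a policy: `((c, q₀, d, e), U, A, R, W, P)`. Here `c` is the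
number of states of a reward machine, `q₀` its initial state, `U q s` its update, `R q s / d - 1` its
reward, `A q s` the action to play, `W q s / d` the solution of the Bellman equation for the rewards
`R q s / d`, and `P s x s' / e` the transition probabilities over a common denominator. -/
abbrev Certificate : Type :=
  (ℕ × ℕ × ℕ × ℕ) × List ℕ × List ℕ × List ℕ × List ℕ × List ℕ

/-- The entries of a certificate are in range. -/
def checkRange (n m c q₀ d e : ℕ) (U A : List ℕ) : Bool :=
  decide (q₀ < c) && decide (0 < d) && decide (0 < e) &&
    (List.range c).all fun q => (List.range n).all fun s =>
      decide (look₂ U q s < c) && decide (look₂ A q s < m)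

/-- The table `P` holds the numerators of the transition probabilities over the denominator `e`. -/
def checkProb (n m e : ℕ) (p : List (List (List (ℕ × ℕ)))) (P : List ℕ) : Bool :=
  (List.range n).all fun s => (List.range m).all fun x => (List.range n).all fun s' =>
    decide (look₃ P s x s' * (((p.getD s []).getD x []).getD s' (0, 0)).2 =
      (((p.getD s []).getD x []).getD s' (0, 0)).1 * e)

/-- The right-hand side of the Bellman equation for the action `x`, multiplied by `b * e * d`. -/
def bellmanNum (n a b e : ℕ) (U R W P : List ℕ) (q s x : ℕ) : ℕ :=
  b * e * look₂ R q s +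
    a * ((List.range n).map fun s' => look₃ P s x s' * look₂ W (look₂ U q s) s').sum

/-- `W` solves the Bellman equation, and `A` attains the maximum. -/
def checkBellman (n m c a b e : ℕ) (U A R W P : List ℕ) : Bool :=
  (List.range c).all fun q => (List.range n).all fun s => (List.range m).all fun x =>
    decide (bellmanNum n a b e U R W P q s x ≤ b * e * look₂ W q s) &&
      (!decide (x = look₂ A q s) ||
        decide (bellmanNum n a b e U R W P q s x = b * e * look₂ W q s))

/-- The rewards of the machine are the increments of the finite-horizon values on all words of length
at most `c * K`. -/
def checkReward (n c K a b d q₀ : ℕ) (T : List (List Bool)) (toks : List (ℕ × ℕ))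
    (U R : List ℕ) : Bool :=
  (List.range (c * K + 1)).all fun l => (words n l).all fun w => (List.range n).all fun s =>
    decide (look₂ R (w.foldl (fun q s => look₂ U q s) q₀) s * (a ^ l * b) +
        d * (b * horizonNum T a b toks w) =
      d * horizonNum T a b toks (w ++ [s]) + d * (a ^ l * b))

/-- The complete test of a certificate for an instance. -/
def checkCertificate (I : InstanceCode) (C : Certificate) : Bool :=
  checkRange I.1.1 I.1.2.1 C.1.1 C.1.2.1 C.1.2.2.1 C.1.2.2.2 C.2.1 C.2.2.1 &&
  (checkProb I.1.1 I.1.2.1 C.1.2.2.2 I.2.2.1 C.2.2.2.2.2 &&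
  (checkBellman I.1.1 I.1.2.1 C.1.1 I.2.2.2.2.1.1 I.2.2.2.2.1.2 C.1.2.2.2
    C.2.1 C.2.2.1 C.2.2.2.1 C.2.2.2.2.1 C.2.2.2.2.2 &&
  checkReward I.1.1 C.1.1 (DLTL.residualBound I.2.2.2.2.1.1 I.2.2.2.2.2.length)
    I.2.2.2.2.1.1 I.2.2.2.2.1.2 C.1.2.2.1 C.1.2.1 I.2.2.2.1 I.2.2.2.2.2 C.2.1 C.2.2.2.1))

/-- The code of the finite-memory policy described by a certificate. -/
def certificatePolicy (n m c q₀ : ℕ) (U A : List ℕ) : PolicyCode :=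
  (c, q₀,
    ((List.range c).map fun q => (List.range n).map fun s => (List.range m).map fun _ => look₂ U q s),
    ((List.range c).map fun q => (List.range n).map fun s => (List.range m).map fun x =>
      bif decide (x = look₂ A q s) then (1, 1) else (0, 1)))

/-- The outcome of testing one certificate. -/
def testCertificate (I : InstanceCode) (C : Certificate) : Option PolicyCode :=
  bif checkCertificate I C then
    some (certificatePolicy I.1.1 I.1.2.1 C.1.1 C.1.2.1 C.2.1 C.2.2.1) else none

/-- The algorithm: an unbounded search for a certificate that passes the test. -/
def searchPolicy (I : InstanceCode) : Part PolicyCode :=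
  Nat.rfindOpt fun j => (Encodable.decode (α := Certificate) j).bind (testCertificate I)

/-! ### Computability of the search -/

section Primrec

variable {α : Type*} [Primcodable α]

@[fun_prop] theorem primrec_words {f g : α → ℕ} (hf : Primrec f) (hg : Primrec g) :
    Primrec fun x => words (f x) (g x) := by
  refine Primrec.of_eq (f := fun x => Nat.rec (motive := fun _ => List (List ℕ)) [[]]
    (fun _ W => W.flatMap fun w => (List.range (f x)).map fun s => w ++ [s]) (g x))
    (by fun_prop) fun x => ?_
  induction g x with
  | zero => rfl
  | succ l ih => rw [words, ← ih]

@[fun_prop] theorem primrec_denomExp {f g h : α → ℕ} (hf : Primrec f) (hg : Primrec g)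
    (hh : Primrec h) : Primrec fun x => denomExp (f x) (g x) (h x) := by
  refine Primrec.of_eq (f := fun x => Nat.rec (motive := fun _ => ℕ) 0
    (fun _ N => N + f x * g x * f x ^ N) (h x)) (by fun_prop) fun x => ?_
  induction h x with
  | zero => rfl
  | succ l ih => rw [denomExp, ← ih]

@[fun_prop] theorem primrec_residualBound {f g : α → ℕ} (hf : Primrec f) (hg : Primrec g) :
    Primrec fun x => DLTL.residualBound (f x) (g x) := by
  unfold DLTL.residualBound; fun_prop

@[fun_prop] theorem primrec_look₂ {t : α → List ℕ} {i j : α → ℕ} (ht : Primrec t)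
    (hi : Primrec i) (hj : Primrec j) : Primrec fun x => look₂ (t x) (i x) (j x) := by
  unfold look₂; fun_prop

@[fun_prop] theorem primrec_look₃ {t : α → List ℕ} {i j k : α → ℕ} (ht : Primrec t)
    (hi : Primrec i) (hj : Primrec j) (hk : Primrec k) :
    Primrec fun x => look₃ (t x) (i x) (j x) (k x) := by
  unfold look₃; fun_prop

@[fun_prop] theorem primrec_checkRange {n m c q₀ d e : α → ℕ} {U A : α → List ℕ} (hn : Primrec n)
    (hm : Primrec m) (hc : Primrec c) (hq : Primrec q₀) (hd : Primrec d) (he : Primrec e)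
    (hU : Primrec U) (hA : Primrec A) :
    Primrec fun x => checkRange (n x) (m x) (c x) (q₀ x) (d x) (e x) (U x) (A x) := by
  unfold checkRange; fun_prop

@[fun_prop] theorem primrec_checkProb {n m e : α → ℕ} {p : α → List (List (List (ℕ × ℕ)))}
    {P : α → List ℕ} (hn : Primrec n) (hm : Primrec m) (he : Primrec e) (hp : Primrec p)
    (hP : Primrec P) : Primrec fun x => checkProb (n x) (m x) (e x) (p x) (P x) := by
  unfold checkProb; fun_prop

@[fun_prop] theorem primrec_bellmanNum {n a b e q s y : α → ℕ} {U R W P : α → List ℕ}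
    (hn : Primrec n) (ha : Primrec a) (hb : Primrec b) (he : Primrec e) (hU : Primrec U)
    (hR : Primrec R) (hW : Primrec W) (hP : Primrec P) (hq : Primrec q) (hs : Primrec s)
    (hy : Primrec y) : Primrec fun x =>
      bellmanNum (n x) (a x) (b x) (e x) (U x) (R x) (W x) (P x) (q x) (s x) (y x) := by
  unfold bellmanNum; fun_prop

@[fun_prop] theorem primrec_checkBellman {n m c a b e : α → ℕ} {U A R W P : α → List ℕ}
    (hn : Primrec n) (hm : Primrec m) (hc : Primrec c) (ha : Primrec a) (hb : Primrec b)
    (he : Primrec e) (hU : Primrec U) (hA : Primrec A) (hR : Primrec R) (hW : Primrec W)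
    (hP : Primrec P) : Primrec fun x =>
      checkBellman (n x) (m x) (c x) (a x) (b x) (e x) (U x) (A x) (R x) (W x) (P x) := by
  unfold checkBellman; fun_prop

@[fun_prop] theorem primrec_checkReward {n c K a b d q₀ : α → ℕ} {T : α → List (List Bool)}
    {toks : α → List (ℕ × ℕ)} {U R : α → List ℕ} (hn : Primrec n) (hc : Primrec c)
    (hK : Primrec K) (ha : Primrec a) (hb : Primrec b) (hd : Primrec d) (hq : Primrec q₀)
    (hT : Primrec T) (ht : Primrec toks) (hU : Primrec U) (hR : Primrec R) : Primrec fun x =>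
      checkReward (n x) (c x) (K x) (a x) (b x) (d x) (q₀ x) (T x) (toks x) (U x) (R x) := by
  unfold checkReward; fun_prop

@[fun_prop] theorem primrec_certificatePolicy {n m c q₀ : α → ℕ} {U A : α → List ℕ}
    (hn : Primrec n) (hm : Primrec m) (hc : Primrec c) (hq : Primrec q₀) (hU : Primrec U)
    (hA : Primrec A) :
    Primrec fun x => certificatePolicy (n x) (m x) (c x) (q₀ x) (U x) (A x) := by
  unfold certificatePolicy; fun_prop

theorem primrec_checkCertificate :
    Primrec fun x : InstanceCode × Certificate => checkCertificate x.1 x.2 := by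
  unfold checkCertificate
  refine PrimrecFun.and ?_ (PrimrecFun.and ?_ (PrimrecFun.and ?_ ?_))
  · apply primrec_checkRange <;> fun_prop
  · apply primrec_checkProb <;> fun_prop
  · apply primrec_checkBellman <;> fun_prop
  · apply primrec_checkReward <;> fun_prop

end Primrec

theorem primrec_testCertificate : Primrec₂ testCertificate := by
  have h : Primrec fun x : InstanceCode × Certificate =>
      certificatePolicy x.1.1.1 x.1.1.2.1 x.2.1.1 x.2.1.2.1 x.2.2.1 x.2.2.2.1 := by
    apply primrec_certificatePolicy <;> fun_prop
  exact Primrec.cond primrec_checkCertificate (Primrec.option_some.comp h) (Primrec.const none)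

theorem partrec_searchPolicy : Partrec searchPolicy := by
  have h1 : Primrec fun x : InstanceCode × ℕ => Encodable.decode (α := Certificate) x.2 :=
    Primrec.decode.comp Primrec.snd
  have h2 : Primrec₂ fun (x : InstanceCode × ℕ) (C : Certificate) => testCertificate x.1 C :=
    primrec_testCertificate.comp (Primrec.fst.comp Primrec.fst) Primrec.snd
  exact Partrec.rfindOpt (Primrec.to_comp (Primrec.option_bind h1 h2))

/-! ### Certificates prove optimality -/

theorem sum_map_range {M : Type*} [AddCommMonoid M] (n : ℕ) (f : ℕ → M) :
    ((List.range n).map f).sum = ∑ i : Fin n, f i := by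
  rw [← Finset.sum_range]; rfl

theorem getD_transitionTable {n m : ℕ} (p : Fin n → Fin m → Fin n → ℚ≥0) (s : Fin n) (x : Fin m)
    (s' : Fin n) :
    (((List.ofFn fun s => List.ofFn fun a => List.ofFn fun s' => ratCode (p s a s')).getD s
      []).getD x []).getD s' (0, 0) = ((p s x s').num, (p s x s').den) := by
  rw [getD_ofFn, getD_ofFn, getD_ofFn, ratCode]

theorem nnrat_cast_eq_div (q : ℚ≥0) : (q : ℝ) = (q.num : ℝ) / q.den := by
  conv_lhs => rw [← NNRat.num_div_den q]
  push_cast; rfl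

theorem nnrat_mul_eq_iff (q : ℚ≥0) (x e : ℕ) : x * q.den = q.num * e ↔ (x : ℝ) = q * e := by
  have h : (q.den : ℝ) ≠ 0 := by exact_mod_cast q.den_ne_zero
  rw [nnrat_cast_eq_div, div_mul_eq_mul_div, eq_div_iff h]
  norm_cast

section Certificate

variable {n m k : ℕ} {M : MDP (Fin n) (Fin m)} {p : Fin n → Fin m → Fin n → ℚ≥0}
  {L : Fin n → Set (Fin k)} {φ : DLTL (Fin k)} {lam : Discount} {ρ : ℚ≥0}

/-- The test of a certificate for an instance, in terms of the mathematical objects. -/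
theorem checkCertificate_iff {c q₀ d e : ℕ} {U A R W P : List ℕ} :
    checkCertificate (instanceCode M.init p L ρ φ) ((c, q₀, d, e), U, A, R, W, P) = true ↔
      (q₀ < c ∧ 0 < d ∧ 0 < e ∧ ∀ q < c, ∀ s : Fin n, look₂ U q s < c ∧ look₂ A q s < m) ∧
      (∀ (s : Fin n) (x : Fin m) (s' : Fin n), (look₃ P s x s' : ℝ) = p s x s' * e) ∧
      (∀ q < c, ∀ (s : Fin n) (x : Fin m),
        bellmanNum n ρ.num ρ.den e U R W P q s x ≤ ρ.den * e * look₂ W q s ∧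
        ((x : ℕ) = look₂ A q s →
          bellmanNum n ρ.num ρ.den e U R W P q s x = ρ.den * e * look₂ W q s)) ∧
      (∀ w : List (Fin n), w.length ≤ c * DLTL.residualBound ρ.num φ.subs.length → ∀ s : Fin n,
        look₂ R ((w.map Fin.val).foldl (fun q s => look₂ U q s) q₀) s *
            (ρ.num ^ w.length * ρ.den) +
          d * (ρ.den * horizonNum (DLTL.labelTable L) ρ.num ρ.den φ.tokens (w.map Fin.val)) =
        d * horizonNum (DLTL.labelTable L) ρ.num ρ.den φ.tokens ((w ++ [s]).map Fin.val) +
          d * (ρ.num ^ w.length * ρ.den)) := by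
  have hI : instanceCode M.init p L ρ φ = ((n, m, k), (M.init : ℕ),
    (List.ofFn fun s => List.ofFn fun a => List.ofFn fun s' => ratCode (p s a s')),
    DLTL.labelTable L, (ρ.num, ρ.den), φ.tokens) := rfl
  rw [hI]
  simp only [checkCertificate, checkRange, checkProb, checkBellman, checkReward,
    Bool.and_eq_true, Bool.or_eq_true, decide_eq_true_eq, List.all_eq_true, List.mem_range,
    Bool.not_eq_true', decide_eq_false_iff_not, DLTL.length_tokens, and_assoc]
  refine and_congr_right fun _ => and_congr_right fun _ => and_congr_right fun _ =>
    and_congr ?_ (and_congr ?_ (and_congr ?_ ?_))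
  · exact ⟨fun h q hq s => h q hq s s.2, fun h q hq s hs => h q hq ⟨s, hs⟩⟩
  · refine ⟨fun h s x s' => ?_, fun h s hs x hx s' hs' => ?_⟩
    · have := h s s.2 x x.2 s' s'.2
      rw [getD_transitionTable] at this
      exact (nnrat_mul_eq_iff _ _ _).1 this
    · have := getD_transitionTable p ⟨s, hs⟩ ⟨x, hx⟩ ⟨s', hs'⟩
      simp only at this
      rw [this]
      exact (nnrat_mul_eq_iff _ _ _).2 (h ⟨s, hs⟩ ⟨x, hx⟩ ⟨s', hs'⟩)
  · simp only [← imp_iff_not_or]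
    exact ⟨fun h q hq s x => h q hq s s.2 x x.2, fun h q hq s hs x hx => h q hq ⟨s, hs⟩ ⟨x, hx⟩⟩
  · refine ⟨fun h w hw s => ?_, fun h l hl w hw s hs => ?_⟩
    · have := h w.length (Nat.lt_succ_of_le hw) _ (map_val_mem_words w) s s.2
      simpa using this
    · obtain ⟨v, rfl, rfl⟩ := exists_of_mem_words hw
      have := h v (Nat.le_of_lt_succ hl) ⟨s, hs⟩
      simpa using this

theorem cast_bellmanNum {a b c d e : ℕ} {U R W P : List ℕ} (hb : 0 < b) (hd : 0 < d) (he : 0 < e)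
    (hP : ∀ (s : Fin n) (x : Fin m) (s' : Fin n), (look₃ P s x s' : ℝ) = p s x s' * e)
    (δ : Fin c → Fin n → Fin c) (hδ : ∀ (q : Fin c) (s : Fin n), look₂ U q s = δ q s) (q : Fin c) (s : Fin n)
    (x : Fin m) : (bellmanNum n a b e U R W P q s x : ℝ) = b * e * d *
      ((look₂ R q s : ℝ) / d + (a : ℝ) / b * ∑ s', p s x s' * ((look₂ W (δ q s) s' : ℝ) / d)) := by
  have hb' : (b : ℝ) ≠ 0 := by exact_mod_cast hb.ne'
  have hd' : (d : ℝ) ≠ 0 := by exact_mod_cast hd.ne'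
  have h : ∑ s', p s x s' * ((look₂ W (δ q s) s' : ℝ) / d) * (e * d) =
      ∑ s' : Fin n, (look₃ P s x s' : ℝ) * look₂ W (δ q s) s' :=
    Finset.sum_congr rfl fun s' _ => by rw [hP]; field_simp
  rw [bellmanNum, sum_map_range, hδ]
  push_cast
  rw [← h, ← Finset.sum_mul]
  field_simp

/-- An accepted certificate describes an optimal policy. -/
theorem exists_optimal_of_check (hp : ∀ s a s', (M.P s a s').toReal = (p s a s' : ℝ))
    (hρ : (lam : ℝ) = (ρ : ℝ)) (hφ : φ.IsUniform lam) {C : Certificate}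
    (hC : checkCertificate (instanceCode M.init p L ρ φ) C = true) :
    ∃ (c : ℕ) (π : MemoryPolicy (Fin c) (Fin n) (Fin m)) (w : Fin c → Fin n → Fin m → ℚ≥0),
      (∀ q s a, (π.act q s a).toReal = (w q s a : ℝ)) ∧ M.IsOptimal L φ π.toPolicy ∧
      policyCode π.init π.update w =
        certificatePolicy n m C.1.1 C.1.2.1 C.2.1 C.2.2.1 := by
  obtain ⟨⟨c, q₀, d, e⟩, U, A, R, W, P⟩ := C
  obtain ⟨⟨hq₀, hd, he, hUA⟩, hP, hB, hR⟩ := checkCertificate_iff.1 hC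
  set a := ρ.num
  set b := ρ.den
  have hb : 0 < b := ρ.den_pos
  have hb' : (b : ℝ) ≠ 0 := by exact_mod_cast hb.ne'
  have hd' : (d : ℝ) ≠ 0 := by exact_mod_cast hd.ne'
  have hd0 : (0 : ℝ) < d := by exact_mod_cast hd
  have hbe : (0 : ℝ) < b * e * d := by
    have : (0 : ℝ) < b := by exact_mod_cast hb
    have : (0 : ℝ) < e := by exact_mod_cast he
    positivity
  have hlam : (lam : ℝ) = (a : ℝ) / b := hρ.trans (nnrat_cast_eq_div ρ)
  have hab : a < b := by
    have := lam.2.2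
    rw [hlam, div_lt_one (by exact_mod_cast hb)] at this
    exact_mod_cast this
  let δ : Fin c → Fin n → Fin c := fun q s => ⟨look₂ U q s, (hUA q q.2 s).1⟩
  let act : Fin c → Fin n → Fin m := fun q s => ⟨look₂ A q s, (hUA q q.2 s).2⟩
  -- the rewards and values are shifted, so that the certificate needs no negative numbers
  let r : Fin c → Fin n → ℝ := fun q s => (look₂ R q s : ℝ) / d - 1
  let V : Fin c → Fin n → ℝ := fun q s => (look₂ W q s : ℝ) / d - 1 / (1 - lam)
  have hfold : ∀ w : List (Fin n), (w.map Fin.val).foldl (fun q s => look₂ U q s) q₀ =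
      (w.foldl δ ⟨q₀, hq₀⟩ : Fin c) := fun w => by
    induction w using List.reverseRecOn with
    | nil => rfl
    | append_singleton w s ih => simp only [List.map_append, List.foldl_append, ih]; rfl
  have hmachine : DLTL.IsRewardMachine L lam φ δ ⟨q₀, hq₀⟩ r := by
    refine DLTL.isRewardMachine_of_bounded hab hlam hφ fun w hw s => ?_
    have h := hR w hw s
    rw [hfold] at h
    have h := congrArg (Nat.cast (R := ℝ)) h
    push_cast at h
    rw [DLTL.horizonNum_eq hb L hlam hφ, DLTL.horizonNum_eq hb L hlam hφ, List.length_append,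
      List.length_singleton] at h
    have hbw : (b : ℝ) ^ w.length ≠ 0 := pow_ne_zero _ hb'
    simp only [r]
    rw [hlam, div_pow]
    field_simp
    rw [pow_succ] at h
    refine mul_left_cancel₀ hb' ?_
    linear_combination h
  have hsum : ∀ s x, ∑ s', (p s x s' : ℝ) = 1 := fun s x => by
    simp only [← hp]; exact MDP.sum_toReal_pmf _
  have hlam1 : (1 - (lam : ℝ)) ≠ 0 := by have := lam.2.2; linarith
  have hAV : ∀ (q : Fin c) (s : Fin n) (x : Fin m), b * e * d * (M.actionValue lam δ r V q s x + 1 / (1 - lam)) =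
      (bellmanNum n a b e U R W P q s x : ℝ) := fun q s x => by
    rw [cast_bellmanNum hb hd he hP δ (fun _ _ => rfl), ← hlam]
    congr 1
    simp only [MDP.actionValue, hp, V, r, mul_sub, Finset.sum_sub_distrib]
    rw [← Finset.sum_mul, hsum]
    field_simp
    ring
  have hV : ∀ (q : Fin c) (s : Fin n), b * e * d * (V q s + 1 / (1 - lam)) =
      ((b * e * look₂ W q s : ℕ) : ℝ) := fun q s => by
    simp only [V]
    push_cast
    field_simp
    ring
  have hopt := MDP.isOptimal_of_bellman M L hφ hmachine V act
    (fun q s x => by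
      have h : (bellmanNum n a b e U R W P q s x : ℝ) ≤ ((b * e * look₂ W q s : ℕ) : ℝ) := by
        exact_mod_cast (hB q q.2 s x).1
      rw [← hAV, ← hV] at h
      linarith [le_of_mul_le_mul_left h hbe])
    (fun q s => by
      have h : (bellmanNum n a b e U R W P q s (act q s) : ℝ) =
          ((b * e * look₂ W q s : ℕ) : ℝ) := by
        exact_mod_cast (hB q q.2 s (act q s)).2 rfl
      rw [← hAV, ← hV] at h
      linarith [mul_left_cancel₀ hbe.ne' h])
  refine ⟨c, _, fun q s x => if x = act q s then 1 else 0, fun q s x => ?_, hopt, ?_⟩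
  · rw [PMF.pure_apply]
    by_cases h : x = act q s <;> simp [h]
  · have hofFn : ∀ {β : Type} (N : ℕ) (f : ℕ → β),
        (List.range N).map f = List.ofFn fun i : Fin N => f i := fun N f => by
      refine List.ext_getElem (by simp) fun i h₁ h₂ => by simp
    simp only [policyCode, certificatePolicy, hofFn]
    refine congrArg (fun T => (c, q₀, _, T)) ?_
    congr 1; funext q; congr 1; funext s; congr 1; funext x
    have hx : (x = act q s) ↔ ((x : ℕ) = look₂ A q s) := Fin.ext_iff
    by_cases h : (x : ℕ) = look₂ A q s
    · rw [if_pos (hx.2 h), decide_eq_true h]; rfl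
    · rw [if_neg (fun h' => h (hx.1 h')), decide_eq_false h]; rfl

/-! ### Every instance has a certificate -/

theorem exists_common_denominator {ι : Type*} [Finite ι] (f : ι → ℚ≥0) :
    ∃ d : ℕ, 0 < d ∧ ∃ g : ι → ℕ, ∀ i, (g i : ℝ) = f i * d := by
  have := Fintype.ofFinite ι
  refine ⟨∏ i, (f i).den, Finset.prod_pos fun i _ => (f i).den_pos, ?_⟩
  have h : ∀ i, ∃ t : ℕ, (t : ℝ) = f i * (∏ i, (f i).den : ℕ) := fun i => by
    obtain ⟨t, ht⟩ := Finset.dvd_prod_of_mem (fun i => (f i).den) (Finset.mem_univ i)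
    refine ⟨(f i).num * t, (nnrat_mul_eq_iff _ _ _).1 ?_⟩
    rw [ht]; ring
  exact ⟨fun i => (h i).choose, fun i => (h i).choose_spec⟩

/-- The rewards of a machine for a rational discount factor are rational. -/
theorem exists_nnrat_reward (hρ : (lam : ℝ) = (ρ : ℝ)) (hφ : φ.IsUniform lam) (w : List (Fin n))
    (s : Fin n) : ∃ x : ℚ≥0, (x : ℝ) = DLTL.residual lam φ (w.map L)
      ⟨DLTL.unfold (L s) 0, DLTL.isUnitValued_unfold (L s) DLTL.isUnitValued_zero⟩ + 1 := by
  have hlam : (lam : ℝ) = (ρ.num : ℝ) / ρ.den := hρ.trans (nnrat_cast_eq_div ρ)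
  have hnum : ∀ v : List (Fin n), ∃ x : ℚ, DLTL.horizon (v.map L) 0 φ = (x : ℝ) := fun v => by
    have h := DLTL.horizonNum_eq ρ.den_pos L hlam hφ v
    have hb : (ρ.den : ℝ) ^ v.length ≠ 0 :=
      pow_ne_zero _ (by exact_mod_cast ρ.den_ne_zero)
    refine ⟨(horizonNum (DLTL.labelTable L) ρ.num ρ.den φ.tokens (v.map Fin.val) : ℚ) /
      (ρ.den : ℚ) ^ v.length, ?_⟩
    push_cast
    rw [h, mul_div_cancel_left₀ _ hb]
  obtain ⟨y, hy⟩ := hnum (w ++ [s])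
  obtain ⟨z, hz⟩ := hnum w
  rw [List.map_append, List.map_singleton, DLTL.horizon_concat] at hy
  have hval : DLTL.residual lam φ (w.map L)
      ⟨DLTL.unfold (L s) 0, DLTL.isUnitValued_unfold (L s) DLTL.isUnitValued_zero⟩ + 1 =
      (((y - z) / (ρ : ℚ) ^ w.length + 1 : ℚ) : ℝ) := by
    rw [DLTL.residual, hy, hz, hρ, List.length_map]
    push_cast; rfl
  have h0 := (abs_le.1 (DLTL.abs_residual_le hφ (w.map L)
    ⟨DLTL.unfold (L s) 0, DLTL.isUnitValued_unfold (L s) DLTL.isUnitValued_zero⟩)).1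
  have h1 : (0 : ℝ) ≤ (((y - z) / (ρ : ℚ) ^ w.length + 1 : ℚ) : ℝ) := by rw [← hval]; linarith
  have h2 : 0 ≤ (y - z) / (ρ : ℚ) ^ w.length + 1 := by exact_mod_cast h1
  refine ⟨((y - z) / (ρ : ℚ) ^ w.length + 1).toNNRat, ?_⟩
  rw [hval]
  conv_rhs => rw [← Rat.coe_toNNRat _ h2]
  norm_cast

/-- A certificate is obtained from the reward machine of the residuals, whose rewards are rational,
and from a rational solution of the Bellman equation, by passing to common denominators. -/
theorem exists_check (hm : 0 < m) (hp : ∀ s a s', (M.P s a s').toReal = (p s a s' : ℝ))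
    (hρ : (lam : ℝ) = (ρ : ℝ)) (hφ : φ.IsUniform lam) :
    ∃ C : Certificate, checkCertificate (instanceCode M.init p L ρ φ) C = true := by
  obtain ⟨c, δ, q₀, r, hr, hres⟩ := DLTL.exists_isRewardMachine L hφ
  have hr1 : ∀ q s, ∃ x : ℚ≥0, (x : ℝ) = r q s + 1 := fun q s => by
    obtain ⟨w, hw⟩ := hres q s
    rw [hw]
    exact exists_nnrat_reward hρ hφ w s
  choose r' hr' using hr1
  obtain ⟨V, act, hle, heq⟩ := MDP.exists_rational_bellman hm M hp hρ δ r'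
  obtain ⟨d, hd, g, hg⟩ := exists_common_denominator
    (fun i : Bool × Fin c × Fin n => if i.1 then r' i.2.1 i.2.2 else V i.2.1 i.2.2)
  obtain ⟨e, he, h, hh⟩ := exists_common_denominator
    (fun i : Fin n × Fin m × Fin n => p i.1 i.2.1 i.2.2)
  obtain ⟨U, hU⟩ := exists_table₂ fun q s => (δ q s : ℕ)
  obtain ⟨A, hA⟩ := exists_table₂ fun q s => (act q s : ℕ)
  obtain ⟨R, hR⟩ := exists_table₂ fun q s => g (true, q, s)
  obtain ⟨W, hW⟩ := exists_table₂ fun q s => g (false, q, s)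
  obtain ⟨P, hP⟩ := exists_table₃ fun s x s' => h (s, x, s')
  have hd' : (d : ℝ) ≠ 0 := by exact_mod_cast hd.ne'
  have hRd : ∀ (q : Fin c) (s : Fin n), (look₂ R q s : ℝ) / d = r' q s := fun q s => by
    rw [hR, hg]; simp [hd']
  have hWd : ∀ (q : Fin c) (s : Fin n), (look₂ W q s : ℝ) / d = V q s := fun q s => by
    rw [hW, hg]; simp [hd']
  have hPe : ∀ (s : Fin n) (x : Fin m) (s' : Fin n), (look₃ P s x s' : ℝ) = p s x s' * e :=
    fun s x s' => by rw [hP, hh]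
  have hlam : (lam : ℝ) = (ρ.num : ℝ) / ρ.den := hρ.trans (nnrat_cast_eq_div ρ)
  have hb := ρ.den_pos
  have hb' : (ρ.den : ℝ) ≠ 0 := by exact_mod_cast hb.ne'
  have hbell : ∀ (q : Fin c) (s : Fin n) (x : Fin m), (bellmanNum n ρ.num ρ.den e U R W P q s x : ℝ) = ρ.den * e * d *
      ((r' q s + ρ * ∑ s', p s x s' * V (δ q s) s' : ℚ≥0) : ℝ) := fun q s x => by
    rw [cast_bellmanNum hb hd he hPe δ hU, hRd, ← nnrat_cast_eq_div]
    simp only [hWd]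
    push_cast; rfl
  have hWV : ∀ (q : Fin c) (s : Fin n), ((ρ.den * e * look₂ W q s : ℕ) : ℝ) =
      ρ.den * e * d * (V q s : ℝ) := fun q s => by
    rw [← hWd]; push_cast; field_simp
  refine ⟨((c, q₀, d, e), U, A, R, W, P), checkCertificate_iff.2
    ⟨⟨q₀.2, hd, he, fun q hq s => ?_⟩, hPe, fun q hq s x => ⟨?_, fun hx => ?_⟩, fun w _ s => ?_⟩⟩
  · have h1 := hU ⟨q, hq⟩ s
    have h2 := hA ⟨q, hq⟩ s
    simp only at h1 h2
    rw [h1, h2]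
    exact ⟨(δ _ _).2, (act _ _).2⟩
  · have h1 : (bellmanNum n ρ.num ρ.den e U R W P q s x : ℝ) ≤
        ((ρ.den * e * look₂ W q s : ℕ) : ℝ) := by
      have h2 := hbell ⟨q, hq⟩ s x
      have h3 := hWV ⟨q, hq⟩ s
      simp only at h2 h3
      rw [h2, h3]
      have := hle ⟨q, hq⟩ s x
      gcongr
    exact_mod_cast h1
  · have hx' : x = act ⟨q, hq⟩ s := Fin.ext (hx.trans (hA ⟨q, hq⟩ s))
    have h1 : (bellmanNum n ρ.num ρ.den e U R W P q s x : ℝ) =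
        ((ρ.den * e * look₂ W q s : ℕ) : ℝ) := by
      have h2 := hbell ⟨q, hq⟩ s x
      have h3 := hWV ⟨q, hq⟩ s
      simp only at h2 h3
      rw [h2, h3, hx', heq]
    exact_mod_cast h1
  · have hfold : ∀ w : List (Fin n), (w.map Fin.val).foldl (fun q s => look₂ U q s) q₀ =
        (w.foldl δ q₀ : Fin c) := fun w => by
      induction w using List.reverseRecOn with
      | nil => rfl
      | append_singleton w s ih =>
        simp only [List.map_append, List.foldl_append, ih, List.map_cons, List.map_nil,
          List.foldl_cons, List.foldl_nil, hU]
    have h1 := hr w s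
    have h2 : (look₂ R (w.foldl δ q₀ : Fin c) s : ℝ) = d * (r (w.foldl δ q₀) s + 1) := by
      rw [← hr', ← hRd]; field_simp
    rw [hfold]
    have : ((look₂ R (w.foldl δ q₀ : Fin c) s * (ρ.num ^ w.length * ρ.den) + d * (ρ.den *
        horizonNum (DLTL.labelTable L) ρ.num ρ.den φ.tokens (w.map Fin.val)) : ℕ) : ℝ) =
        ((d * horizonNum (DLTL.labelTable L) ρ.num ρ.den φ.tokens ((w ++ [s]).map Fin.val) +
          d * (ρ.num ^ w.length * ρ.den) : ℕ) : ℝ) := by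
      push_cast
      rw [DLTL.horizonNum_eq hb L hlam hφ, DLTL.horizonNum_eq hb L hlam hφ, List.length_append,
        List.length_singleton, h2]
      rw [hlam, div_pow] at h1
      have hbw : (ρ.den : ℝ) ^ w.length ≠ 0 := pow_ne_zero _ hb'
      field_simp at h1
      rw [pow_succ]
      linear_combination d * ρ.den * h1
    exact_mod_cast this

end Certificate

theorem mainTheorem4 :
    -- existence, for all finite MDPs
    (∀ (S A AP : Type*) [Fintype S] [MeasurableSpace S] [MeasurableSingletonClass S]
        [Fintype A] [Nonempty A] [MeasurableSpace A] [MeasurableSingletonClass A] [Finite AP]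
        (M : MDP S A) (L : S → Set AP) (φ : DLTL AP) (lam : Discount),
        φ.IsUniform lam →
        ∃ (Q : Type) (_ : Finite Q) (π : MemoryPolicy Q S A), M.IsOptimal L φ π.toPolicy) ∧
    -- a single algorithm that halts on every finitely represented instance and outputs such a policy
    (∃ alg : InstanceCode →. PolicyCode, Partrec alg ∧
      ∀ (n m k : ℕ) (_ : 0 < m) (M : MDP (Fin n) (Fin m)) (p : Fin n → Fin m → Fin n → ℚ≥0)
        (_ : ∀ s a s', (M.P s a s').toReal = (p s a s' : ℝ))
        (L : Fin n → Set (Fin k)) (φ : DLTL (Fin k)) (lam : Discount) (r : ℚ≥0)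
        (_ : (lam : ℝ) = (r : ℝ)) (_ : φ.IsUniform lam),
        ∃ (c : ℕ) (π : MemoryPolicy (Fin c) (Fin n) (Fin m)) (w : Fin c → Fin n → Fin m → ℚ≥0),
          (∀ q s a, (π.act q s a).toReal = (w q s a : ℝ)) ∧
          M.IsOptimal L φ π.toPolicy ∧
          policyCode π.init π.update w ∈ alg (instanceCode M.init p L r φ)) := by
  refine ⟨?_, searchPolicy, partrec_searchPolicy, ?_⟩
  · intro S A AP _ _ _ _ _ _ _ _ M L φ lam hφ
    obtain ⟨c, δ, q₀, r, hr, -⟩ := DLTL.exists_isRewardMachine L hφ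
    obtain ⟨V, act, hle, heq⟩ := M.exists_bellman lam δ r
    exact ⟨Fin c, inferInstance, _, MDP.isOptimal_of_bellman M L hφ hr V act hle heq⟩
  · intro n m k hm M p hp L φ lam ρ hρ hφ
    obtain ⟨C, hC⟩ := exists_check hm hp hρ hφ (L := L)
    have hdom : (searchPolicy (instanceCode M.init p L ρ φ)).Dom :=
      Nat.rfindOpt_dom.2 ⟨Encodable.encode C, _, by
        rw [Encodable.encodek, Option.bind_some, testCertificate, hC]; rfl⟩
    -- the accepted certificate need not be the constructed one, but it proves optimality as well
    obtain ⟨j, hj⟩ := Nat.rfindOpt_spec (Part.get_mem hdom)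
    obtain ⟨C', -, hC'⟩ := Option.bind_eq_some_iff.1 hj
    rw [testCertificate] at hC'
    cases hcheck : checkCertificate (instanceCode M.init p L ρ φ) C' with
    | false => rw [hcheck] at hC'; simp at hC'
    | true =>
      rw [hcheck, cond_true, Option.some.injEq] at hC'
      obtain ⟨c, π, w, hw, hopt, hcode⟩ := exists_optimal_of_check hp hρ hφ hcheck
      refine ⟨c, π, w, hw, hopt, ?_⟩
      rw [hcode]
      exact hC' ▸ Part.get_mem hdom
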